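/- Let $p\ge 2$ be an integer, $\beta\in\mathbb R$, $\gamma\ge 0$, $\alpha>0$, and let $\mathbb Q\in\{\mathbb H,\mathbb T\}$. For an integer $n\ge 2$ consider the knots $t_1=\dots=t_{p+1}=0$, $t_{p+1+i}=i/n$ $(0\le i\le n)$, $t_{p+n+1}=\dots=t_{2p+n+1}=1$, and let the parameter $\mu$ be either $\alpha$ for all $n$ (nested case) or $n\alpha$ for all $n$ (non-nested case). If $\mathbb Q=\mathbb T$, only those $n$ with $\mu/n<\pi$ are considered. Put $s(x)=\sinh x$ if $\mathbb Q=\mathbb H$ and $s(x)=\sin x$ if $\mathbb Q=\mathbb T$. The generalized B-splines $N_{i,k}=N_{i,k}^{\mathbb Q_\mu}$ are defined by $$N_{i,1}(x)=\begin{cases}\dfrac{s(\mu(x-t_i))}{s(\mu(t_{i+1}-t_i))}, & x\in[t_i,t_{i+1}),\\[2mm] \dfrac{s(\mu(t_{i+2}-x))}{s(\mu(t_{i+2}-t_{i+1}))}, & x\in[t_{i+1},t_{i+2}),\\[2mm] 0,&\text{otherwise,}\end{cases}$$ $$N_{i,k}(x)=\Phi_{i,k-1}(x)-\Phi_{i+1,k-1}(x)\quad(2\le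 k\le p),\qquad \Phi_{i,k}(x)=\frac{\int_0^xN_{i,k}(y)\,dy}{\int_0^1N_{i,k}(y)\,dy},$$ where $\Phi_{i,k}$ is understood as the unit step ($1$ for $x\ge t_{i+k+1}$, $0$ otherwise) if $t_i=t_{i+k+1}$. Let $A_{n,p}^{\mathbb Q_\mu}=[a(N_{j+1,p},N_{i+1,p})]_{i,j=1}^{n+p-2}$, where $a(u,v)=\int_0^1u'v'\,dx+\beta\int_0^1u'v\,dx+\gamma\int_0^1uv\,dx$, be the Galerkin matrix of the problem $-u''+\beta u'+\gamma u=f$ on $(0,1)$, $u(0)=u(1)=0$. Then, in both the nested and the non-nested case, there exists a constant $\alpha_p>0$, depending only on $p$, $\mathbb Q$, the choice of case, $\alpha$, $\beta$, $\gamma$ (and not on $n$), such that for every $n\ge 2$ (with $\mu/n<\pi$ if $\mathbb Q=\mathbb T$) the matrix $A_{n,p}^{\mathbb Q_\mu}$ is invertible and $$\kappa_2(A_{n,p}^{\mathbb Q_\mu}):=\|A_{n,p}^{\mathbb Q_\mu}\|\,\|(A_{n,p}^{\mathbb Q_\mu})^{-1}\|\le \alpha_p\,n^2,$$ where $\|\cdot\|$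 is the spectral (Euclidean operator) norm. -/

import Mathlib

noncomputable section

namespace GBSpline

/-- The two kinds of section spaces of degree `p` with parameter `θ`:
hyperbolic, `⟨1, x, …, x^(p-2), cosh (θ x), sinh (θ x)⟩`, and
trigonometric, `⟨1, x, …, x^(p-2), cos (θ x), sin (θ x)⟩`. -/
inductive Kind where
  | hyperbolic
  | trigonometric

/-- The odd generator of the section space: `sinh` or `sin`. -/
def Kind.odd : Kind → ℝ → ℝ
  | .hyperbolic => Real.sinh
  | .trigonometric => Real.sin

/-- The choice of the section-space parameter as a function of the number `n` of knot intervals: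
`α` itself (nested spaces) or `n α` (non-nested spaces). -/
inductive Mode where
  | nested
  | nonNested

/-- The section-space parameter, `α` in the nested case and `n α` in the non-nested case. -/
def Mode.param : Mode → ℝ → ℕ → ℝ
  | .nested, α, _ => α
  | .nonNested, α, n => n * α

/-- Admissibility of the parameter `θ` for the uniform mesh of step `1 / n`: in the trigonometric
case the length of every knot interval times `θ` has to be smaller than `π`, so that `cos (θ x)`,
`sin (θ x)` form a Chebyshev system on each closed knot interval. -/
def Admissible : Kind → ℝ → ℕ → Prop
  | .hyperbolic, _, _ => True
  | .trigonometric, θ, n => θ / n < Real.pi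

/-- The open uniform knot sequence `t_1, …, t_{2p+n+1}` on `[0, 1]` of degree `p` with `n`
intervals: `t_1 = ⋯ = t_{p+1} = 0`, `t_{p+1+i} = i / n` for `0 ≤ i ≤ n`,
`t_{p+n+1} = ⋯ = t_{2p+n+1} = 1`. -/
def knot (n p i : ℕ) : ℝ :=
  if i ≤ p + 1 then 0
  else if i ≤ p + n then ((i : ℝ) - (p + 1)) / n
  else 1

/-- The element of `⟨cosh (θ x), sinh (θ x)⟩` (resp. `⟨cos (θ x), sin (θ x)⟩`) with value `0` at `a`
and value `1` at `b`. -/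
def rising (Q : Kind) (θ a b x : ℝ) : ℝ :=
  Q.odd (θ * (x - a)) / Q.odd (θ * (b - a))

/-- The element of `⟨cosh (θ x), sinh (θ x)⟩` (resp. `⟨cos (θ x), sin (θ x)⟩`) with value `1` at `a`
and value `0` at `b`. -/
def falling (Q : Kind) (θ a b x : ℝ) : ℝ :=
  Q.odd (θ * (b - x)) / Q.odd (θ * (b - a))

/-- The normalized primitive `(∫_0^x f) / (∫_0^1 f)` of a spline `f` with support `[a, b]`. If
`a = b`, then `f` vanishes identically and, as usual for multiple knots, the normalized primitive
is the unit step at `b`. -/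
def normPrimitive (f : ℝ → ℝ) (a b x : ℝ) : ℝ :=
  if a = b then (if b ≤ x then 1 else 0)
  else (∫ s in (0 : ℝ)..x, f s) / (∫ s in (0 : ℝ)..1, f s)

/-- The GB-spline `N_{i,k}` of degree `k` over the knot sequence `t` (supported on
`[t_i, t_{i+k+1}]`), by the integral recursion; the value in degree `0` is a placeholder. -/
def gbSpline (Q : Kind) (θ : ℝ) (t : ℕ → ℝ) : ℕ → ℕ → ℝ → ℝ
  | 0, _ => fun _ => 0
  | 1, i => fun x =>
      if t i ≤ x ∧ x < t (i + 1) then rising Q θ (t i) (t (i + 1)) x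
      else if t (i + 1) ≤ x ∧ x < t (i + 2) then falling Q θ (t (i + 1)) (t (i + 2)) x
      else 0
  | k + 2, i => fun x =>
      normPrimitive (gbSpline Q θ t (k + 1) i) (t i) (t (i + k + 2)) x
        - normPrimitive (gbSpline Q θ t (k + 1) (i + 1)) (t (i + 1)) (t (i + k + 3)) x

/-- The bilinear form `a(u, v) = ∫_0^1 u' v' + β ∫_0^1 u' v + γ ∫_0^1 u v` of the problem
`-u'' + β u' + γ u = f` on `(0, 1)` with `u(0) = u(1) = 0`. -/
def bilin (β γ : ℝ) (u v : ℝ → ℝ) : ℝ :=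
  (∫ x in (0 : ℝ)..1, deriv u x * deriv v x)
    + β * (∫ x in (0 : ℝ)..1, deriv u x * v x)
    + γ * (∫ x in (0 : ℝ)..1, u x * v x)

/-- The Galerkin matrix `[a(N_{j+1,p}, N_{i+1,p})]`, `i, j = 1, …, n + p - 2`, in the GB-spline basis
`N_{2,p}, …, N_{n+p-1,p}`. The indices of `Fin (n + p - 2)` start from `0`. -/
def galerkinMatrix (Q : Kind) (θ : ℝ) (n p : ℕ) (β γ : ℝ) :
    Matrix (Fin (n + p - 2)) (Fin (n + p - 2)) ℝ :=
  Matrix.of fun i j =>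
    bilin β γ (gbSpline Q θ (knot n p) p ((j : ℕ) + 2)) (gbSpline Q θ (knot n p) p ((i : ℕ) + 2))

/-- The spectral condition number `‖A‖ ‖A⁻¹‖` (operator norms for the Euclidean norm). -/
def cond2 {ι : Type*} [Fintype ι] [DecidableEq ι] (A : Matrix ι ι ℝ) : ℝ :=
  ‖Matrix.toEuclideanCLM (𝕜 := ℝ) A‖ * ‖Matrix.toEuclideanCLM (𝕜 := ℝ) A⁻¹‖

end GBSpline

end

open Set MeasureTheory

namespace GBSpline

/-! ### Condition numbers from coercivity and boundedness -/

/-! Testing the form with u gives a(u, u) = ‖u'‖² + γ‖u‖², since the advection term integrates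
(u²/2)' between zeros. Because |u| ≤ ‖u'‖ pointwise, also |a(u, v)| ≤ (1 + |β| + γ)‖u'‖‖v'‖. So it
suffices to compare ‖u'‖² with the Euclidean norm of the coefficients c of u: if m|c|² ≤ ‖u'‖² ≤
M|c|², then κ₂ ≤ (1 + |β| + γ)M/m (`galerkin_cond2_le`).

Upper bound, M of order n: u' is a spline of one degree less with coefficients (c_i - c_{i-1})/∫N_i,
and ∫N_i is of order 1/n (`Regular.integral_dspl_sq_le`). Lower bound, m of order 1/n: each |c_i| is
at most a constant times sup|u| by local stability of the basis, sup|u| ≤ ‖u'‖, and there are O(n)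
coefficients. Together M/m = O(n²).

The spline facts, uniform in n, are collected in `Regular` and proved by induction on the degree
(`regular_one`, `Regular.succ`). Three ideas drive the induction. An inverse inequality
(`abs_le_of_integral_of_lipschitz`) bounds u' by O(n) times sup|u| on a knot interval. Bounds on the
coefficients of u' control the differences of the c_i, and the partition of unity then controls the
c_i. Finally, nonnegativity of the basis comes from a discrete Rolle argument: a wrong-sign
alternation of a spline would pass to its derivative, and so down to degree one.

The parameter enters only through δ = θ/n in degree one, where `exists_oddBound` supplies a constant
K valid for all admissible n. -/

theorem isUnit_and_cond2_le {ι : Type*} [Fintype ι] [DecidableEq ι] (A : Matrix ι ι ℝ) {m M : ℝ}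
    (hm : 0 < m) (hM : 0 ≤ M)
    (hlow : ∀ x : ι → ℝ, m * ∑ i, x i ^ 2 ≤ x ⬝ᵥ A.mulVec x)
    (hup : ∀ x y : ι → ℝ,
      |y ⬝ᵥ A.mulVec x| ≤ M * (√(∑ i, x i ^ 2) * √(∑ i, y i ^ 2))) :
    IsUnit A ∧ cond2 A ≤ M / m := by
  have hinner : ∀ x y : EuclideanSpace ℝ ι, inner ℝ y x = y.ofLp ⬝ᵥ x.ofLp := by
    intro x y
    simp [PiLp.inner_apply, dotProduct, mul_comm]
  have hnorm : ∀ x : EuclideanSpace ℝ ι, √(∑ i, x.ofLp i ^ 2) = ‖x‖ := by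
    intro x
    simp [EuclideanSpace.norm_eq]
  have hsq : ∀ x : EuclideanSpace ℝ ι, ∑ i, x.ofLp i ^ 2 = ‖x‖ ^ 2 := by
    intro x
    rw [← hnorm, Real.sq_sqrt (Finset.sum_nonneg fun i _ => sq_nonneg _)]
  have hinj : IsUnit A := by
    rw [← Matrix.mulVec_injective_iff_isUnit]
    intro x y hxy
    have h0 : A.mulVec (x - y) = 0 := by
      rw [Matrix.mulVec_sub]; exact sub_eq_zero.2 hxy
    have h1 := hlow (x - y)
    rw [h0, dotProduct_zero] at h1
    have h2 : ∑ i, (x - y) i ^ 2 ≤ 0 := by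
      by_contra h
      push Not at h
      have := mul_pos hm h
      linarith
    have h3 : ∑ i, (x - y) i ^ 2 = 0 :=
      le_antisymm h2 (Finset.sum_nonneg fun i _ => sq_nonneg _)
    rw [Finset.sum_eq_zero_iff_of_nonneg fun i _ => sq_nonneg _] at h3
    funext i
    have := h3 i (Finset.mem_univ i)
    have := pow_eq_zero_iff (two_ne_zero) |>.1 this
    simpa [sub_eq_zero] using this
  refine ⟨hinj, ?_⟩
  have hA : ‖Matrix.toEuclideanCLM (𝕜 := ℝ) A‖ ≤ M := by
    refine ContinuousLinearMap.opNorm_le_bound _ hM fun x => ?_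
    set y := Matrix.toEuclideanCLM (𝕜 := ℝ) A x with hy
    have hyx : y.ofLp = A.mulVec x.ofLp := by
      rw [hy, Matrix.ofLp_toEuclideanCLM]
    -- Testing with y = A x turns the bound on the bilinear form into ‖A x‖² ≤ M‖x‖‖A x‖.
    have h1 := hup x.ofLp y.ofLp
    rw [hnorm, hnorm, ← hyx, ← hinner, real_inner_self_eq_norm_sq, abs_of_nonneg (sq_nonneg _)] at h1
    by_cases h0 : ‖y‖ = 0
    · rw [h0]; positivity
    · have : 0 < ‖y‖ := lt_of_le_of_ne (norm_nonneg _) (Ne.symm h0)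
      nlinarith
  have hAi : ‖Matrix.toEuclideanCLM (𝕜 := ℝ) A⁻¹‖ ≤ 1 / m := by
    refine ContinuousLinearMap.opNorm_le_bound _ (by positivity) fun y => ?_
    set x := Matrix.toEuclideanCLM (𝕜 := ℝ) A⁻¹ y with hx
    have hxy : A.mulVec x.ofLp = y.ofLp := by
      rw [hx, Matrix.ofLp_toEuclideanCLM, Matrix.mulVec_mulVec,
        Matrix.mul_nonsing_inv _ ((Matrix.isUnit_iff_isUnit_det A).1 hinj), Matrix.one_mulVec]
    have h1 := hlow x.ofLp
    rw [hxy, hsq, ← hinner] at h1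
    have h2 := real_inner_le_norm x y
    by_cases h0 : ‖x‖ = 0
    · rw [h0]; positivity
    · have h3 : 0 < ‖x‖ := lt_of_le_of_ne (norm_nonneg _) (Ne.symm h0)
      rw [div_mul_eq_mul_div, le_div_iff₀ hm]
      nlinarith
  calc cond2 A ≤ M * (1 / m) := mul_le_mul hA hAi (norm_nonneg _) hM
    _ = M / m := by ring

/-! ### Integral inequalities on the unit interval -/

theorem sq_integral_mul_le {u v : ℝ → ℝ}
    (huu : IntervalIntegrable (fun x => u x ^ 2) volume 0 1)
    (huv : IntervalIntegrable (fun x => u x * v x) volume 0 1)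
    (hvv : IntervalIntegrable (fun x => v x ^ 2) volume 0 1) :
    (∫ x in (0 : ℝ)..1, u x * v x) ^ 2 ≤
      (∫ x in (0 : ℝ)..1, u x ^ 2) * ∫ x in (0 : ℝ)..1, v x ^ 2 := by
  have h : ∀ t : ℝ, 0 ≤ (∫ x in (0 : ℝ)..1, v x ^ 2) * (t * t)
      + (2 * ∫ x in (0 : ℝ)..1, u x * v x) * t + ∫ x in (0 : ℝ)..1, u x ^ 2 := by
    intro t
    have h1 : 0 ≤ ∫ x in (0 : ℝ)..1, (u x + t * v x) ^ 2 :=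
      intervalIntegral.integral_nonneg zero_le_one fun x _ => sq_nonneg _
    have h2 : ∫ x in (0 : ℝ)..1, (u x + t * v x) ^ 2 = ∫ x in (0 : ℝ)..1,
        ((t * t) * v x ^ 2 + (2 * t) * (u x * v x) + u x ^ 2) := by
      congr 1; funext x; ring
    rw [h2, intervalIntegral.integral_add ((hvv.const_mul _).add (huv.const_mul _)) huu,
      intervalIntegral.integral_add (hvv.const_mul _) (huv.const_mul _),
      intervalIntegral.integral_const_mul, intervalIntegral.integral_const_mul] at h1
    linarith
  have := discrim_le_zero h
  rw [discrim] at this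
  nlinarith

theorem integral_abs_le_sqrt {w : ℝ → ℝ} (hw : IntervalIntegrable w volume 0 1)
    (hww : IntervalIntegrable (fun x => w x ^ 2) volume 0 1) :
    ∫ x in (0 : ℝ)..1, |w x| ≤ √(∫ x in (0 : ℝ)..1, w x ^ 2) := by
  have h := sq_integral_mul_le (u := fun x => |w x|) (v := fun _ => 1)
    (by simpa using hww) (by simpa using hw.abs) (by simp)
  refine Real.le_sqrt_of_sq_le ?_
  simpa using h

theorem abs_integral_mul_le {u v : ℝ → ℝ}
    (huu : IntervalIntegrable (fun x => u x ^ 2) volume 0 1)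
    (huv : IntervalIntegrable (fun x => u x * v x) volume 0 1)
    (hvv : IntervalIntegrable (fun x => v x ^ 2) volume 0 1) :
    |∫ x in (0 : ℝ)..1, u x * v x| ≤
      √(∫ x in (0 : ℝ)..1, u x ^ 2) * √(∫ x in (0 : ℝ)..1, v x ^ 2) := by
  rw [← Real.sqrt_mul (intervalIntegral.integral_nonneg zero_le_one fun x _ => sq_nonneg _)]
  exact Real.abs_le_sqrt (sq_integral_mul_le huu huv hvv)

theorem intervalIntegrable_of_abs_le {w : ℝ → ℝ} (hw : Measurable w) {a b C : ℝ}
    (hC : ∀ x ∈ uIcc a b, |w x| ≤ C) : IntervalIntegrable w volume a b := by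
  refine (intervalIntegrable_const (c := C)).mono_fun' hw.aestronglyMeasurable ?_
  filter_upwards [ae_restrict_mem measurableSet_uIoc] with x hx
  exact hC x (uIoc_subset_uIcc hx)

theorem integral_sum_mul_sum {ι : Type*} [Fintype ι] {g h : ι → ℝ → ℝ}
    (hgh : ∀ i j, IntervalIntegrable (fun x => g j x * h i x) volume 0 1) (x y : ι → ℝ) :
    ∫ s in (0 : ℝ)..1, (∑ j, x j * g j s) * (∑ i, y i * h i s) =
      ∑ i, ∑ j, y i * ((∫ s in (0 : ℝ)..1, g j s * h i s) * x j) := by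
  have h1 : ∀ s, (∑ j, x j * g j s) * (∑ i, y i * h i s) =
      ∑ i, ∑ j, (y i * x j) * (g j s * h i s) := by
    intro s
    rw [Finset.sum_mul_sum, Finset.sum_comm]
    refine Finset.sum_congr rfl fun i _ => Finset.sum_congr rfl fun j _ => by ring
  simp_rw [h1]
  rw [intervalIntegral.integral_finsetSum]
  · refine Finset.sum_congr rfl fun i _ => ?_
    rw [intervalIntegral.integral_finsetSum]
    · refine Finset.sum_congr rfl fun j _ => ?_
      rw [intervalIntegral.integral_const_mul]; ring
    · intro j _; exact (hgh i j).const_mul _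
  · intro i _
    have := IntervalIntegrable.sum (μ := volume) (a := (0 : ℝ)) (b := 1) Finset.univ
      (f := fun j s => (y i * x j) * (g j s * h i s)) fun j _ => (hgh i j).const_mul _
    rw [Finset.sum_fn] at this
    exact this

/-! ### Galerkin matrices of piecewise smooth bases -/

section Galerkin

variable {u g : ℝ → ℝ} {S : Set ℝ}

/-- `u` vanishes at `0` and `1` and is a primitive of the bounded function `g`, with
`u' = g` outside of the countable set `S`. -/
structure IsPrimitive (S : Set ℝ) (u g : ℝ → ℝ) : Prop where
  countable : S.Countable
  measurable : Measurable g
  bounded : ∃ C, ∀ x ∈ Icc (0 : ℝ) 1, |g x| ≤ C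
  zero : u 0 = 0
  one : u 1 = 0
  continuousOn : ContinuousOn u (Icc 0 1)
  hasDerivAt : ∀ x ∈ Ioo (0 : ℝ) 1 \ S, HasDerivAt u (g x) x

theorem IsPrimitive.sum {ι : Type*} [Fintype ι] {u g : ι → ℝ → ℝ} (hS : S.Countable)
    (h : ∀ j, IsPrimitive S (u j) (g j)) (c : ι → ℝ) :
    IsPrimitive S (fun s => ∑ j, c j * u j s) (fun s => ∑ j, c j * g j s) where
  countable := hS
  measurable := Finset.measurable_sum _ fun j _ => (h j).measurable.const_mul _
  bounded := by
    choose C hC using fun j => (h j).bounded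
    refine ⟨∑ j, |c j| * C j, fun x hx => ?_⟩
    refine (Finset.abs_sum_le_sum_abs _ _).trans (Finset.sum_le_sum fun j _ => ?_)
    rw [abs_mul]
    exact mul_le_mul_of_nonneg_left (hC j x hx) (abs_nonneg _)
  zero := by simp [(h _).zero]
  one := by simp [(h _).one]
  continuousOn := continuousOn_finsetSum _ fun j _ => continuousOn_const.mul (h j).continuousOn
  hasDerivAt := fun x hx => HasDerivAt.fun_sum fun j _ => ((h j).hasDerivAt x hx).const_mul _

theorem IsPrimitive.intervalIntegrable (h : IsPrimitive S u g) :
    IntervalIntegrable g volume 0 1 := by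
  obtain ⟨C, hC⟩ := h.bounded
  exact intervalIntegrable_of_abs_le h.measurable (C := C) (by simpa using hC)

theorem IsPrimitive.mul {u' g' : ℝ → ℝ} (h : IsPrimitive S u g) (h' : IsPrimitive S u' g') :
    IntervalIntegrable (fun x => g x * g' x) volume 0 1 := by
  obtain ⟨C, hC⟩ := h.bounded
  obtain ⟨C', hC'⟩ := h'.bounded
  refine intervalIntegrable_of_abs_le (h.measurable.mul h'.measurable) (C := C * C') ?_
  intro x hx
  rw [uIcc_of_le zero_le_one] at hx
  simp only [Pi.mul_apply, abs_mul]
  exact mul_le_mul (hC x hx) (hC' x hx) (abs_nonneg _) ((abs_nonneg _).trans (hC x hx))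

theorem IsPrimitive.mul_right {u' g' : ℝ → ℝ} (h : IsPrimitive S u g) (h' : IsPrimitive S u' g') :
    IntervalIntegrable (fun x => g x * u' x) volume 0 1 :=
  h.intervalIntegrable.mul_continuousOn (by simpa using h'.continuousOn)

theorem IsPrimitive.mul_self {u' g' : ℝ → ℝ} (h : IsPrimitive S u g) (h' : IsPrimitive S u' g') :
    IntervalIntegrable (fun x => u x * u' x) volume 0 1 :=
  ContinuousOn.intervalIntegrable
    (by rw [uIcc_of_le zero_le_one]; exact h.continuousOn.mul h'.continuousOn)

theorem IsPrimitive.integral_eq (h : IsPrimitive S u g) {x : ℝ} (hx : x ∈ Icc (0 : ℝ) 1) :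
    ∫ s in (0 : ℝ)..x, g s = u x := by
  have := MeasureTheory.integral_eq_of_hasDerivAt_off_countable_of_le u g hx.1
    h.countable (h.continuousOn.mono (Icc_subset_Icc_right hx.2))
    (fun y hy => h.hasDerivAt y ⟨⟨hy.1.1, hy.1.2.trans_le hx.2⟩, hy.2⟩)
    (h.intervalIntegrable.mono_set (by
      rw [uIcc_of_le hx.1, uIcc_of_le zero_le_one]; exact Icc_subset_Icc_right hx.2))
  rw [this, h.zero, sub_zero]

theorem IsPrimitive.integral_mul_eq_zero (h : IsPrimitive S u g) :
    ∫ s in (0 : ℝ)..1, g s * u s = 0 := by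
  have := MeasureTheory.integral_eq_of_hasDerivAt_off_countable_of_le
    (fun s => u s ^ 2 / 2) (fun s => g s * u s) zero_le_one h.countable
    ((h.continuousOn.pow 2).div_const 2)
    (by
      intro y hy
      refine (((h.hasDerivAt y hy).pow 2).div_const 2).congr_deriv ?_
      simp only [Nat.cast_ofNat, Nat.add_one_sub_one, pow_one]
      ring)
    (h.mul_right h)
  rw [this, h.zero, h.one]; simp

/-- One-dimensional Sobolev embedding: u(0) = 0 makes u the integral of g. It serves both for the
lower-order terms of the form and for passing from ‖u'‖ to sup|u|. -/
theorem IsPrimitive.abs_le (h : IsPrimitive S u g) {x : ℝ} (hx : x ∈ Icc (0 : ℝ) 1) :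
    |u x| ≤ √(∫ s in (0 : ℝ)..1, g s ^ 2) := by
  rw [← h.integral_eq hx]
  calc |∫ s in (0 : ℝ)..x, g s| ≤ ∫ s in (0 : ℝ)..x, |g s| :=
        intervalIntegral.abs_integral_le_integral_abs hx.1
    _ ≤ ∫ s in (0 : ℝ)..1, |g s| :=
        intervalIntegral.integral_mono_interval le_rfl hx.1 hx.2
          (Filter.Eventually.of_forall fun _ => abs_nonneg _) h.intervalIntegrable.abs
    _ ≤ _ := integral_abs_le_sqrt h.intervalIntegrable (by simpa [sq] using h.mul h)

/-- The exceptional set is countable, hence null, so the junk values of `deriv` at the knots do not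
matter. -/
theorem IsPrimitive.integral_deriv_mul (h : IsPrimitive S u g) (w w' : ℝ → ℝ)
    (hw : ∀ x ∈ Ioo (0 : ℝ) 1 \ S, w x = w' x) :
    ∫ x in (0 : ℝ)..1, deriv u x * w x = ∫ x in (0 : ℝ)..1, g x * w' x := by
  refine intervalIntegral.integral_congr_ae ?_
  have h1 : ∀ᵐ x : ℝ, x ∉ S := h.countable.ae_notMem _
  have h2 : ∀ᵐ x : ℝ, x ≠ 1 := by
    simpa using (countable_singleton (1 : ℝ)).ae_notMem volume
  filter_upwards [h1, h2] with x hx1 hx2 hx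
  rw [uIoc_of_le zero_le_one] at hx
  have hx' : x ∈ Ioo (0 : ℝ) 1 \ S := ⟨⟨hx.1, lt_of_le_of_ne hx.2 hx2⟩, hx1⟩
  rw [(h.hasDerivAt x hx').deriv, hw x hx']

/-- Coercivity uses that the β-term vanishes on the diagonal and γ ≥ 0. Continuity bounds each of
the three integrals by X Y, the product of the two energy norms. -/
theorem galerkin_cond2_le {ι : Type*} [Fintype ι] [DecidableEq ι] {u g : ι → ℝ → ℝ}
    (h : ∀ j, IsPrimitive S (u j) (g j)) (hS : S.Countable) {β γ : ℝ} (hγ : 0 ≤ γ) {m M : ℝ}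
    (hm : 0 < m) (hM : 0 ≤ M)
    (hlow : ∀ c : ι → ℝ, m * ∑ j, c j ^ 2 ≤ ∫ s in (0 : ℝ)..1, (∑ j, c j * g j s) ^ 2)
    (hup : ∀ c : ι → ℝ, ∫ s in (0 : ℝ)..1, (∑ j, c j * g j s) ^ 2 ≤ M * ∑ j, c j ^ 2) :
    IsUnit (Matrix.of fun i j => bilin β γ (u j) (u i)) ∧
      cond2 (Matrix.of fun i j => bilin β γ (u j) (u i)) ≤ (1 + |β| + γ) * M / m := by
  have hform : ∀ x y : ι → ℝ, y ⬝ᵥ (Matrix.of fun i j => bilin β γ (u j) (u i)).mulVec x =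
      (∫ s in (0 : ℝ)..1, (∑ j, x j * g j s) * (∑ i, y i * g i s))
      + β * (∫ s in (0 : ℝ)..1, (∑ j, x j * g j s) * (∑ i, y i * u i s))
      + γ * (∫ s in (0 : ℝ)..1, (∑ j, x j * u j s) * (∑ i, y i * u i s)) := by
    intro x y
    rw [integral_sum_mul_sum (fun i j => (h j).mul (h i)),
      integral_sum_mul_sum (fun i j => (h j).mul_right (h i)),
      integral_sum_mul_sum (fun i j => (h j).mul_self (h i))]
    simp only [dotProduct, Matrix.mulVec, Matrix.of_apply, Finset.mul_sum,
      ← Finset.sum_add_distrib]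
    refine Finset.sum_congr rfl fun i _ => Finset.sum_congr rfl fun j _ => ?_
    rw [bilin, (h j).integral_deriv_mul _ (g i) fun x hx => ((h i).hasDerivAt x hx).deriv,
      (h j).integral_deriv_mul _ (u i) fun x hx => rfl]
    ring
  refine isUnit_and_cond2_le _ hm (by positivity) ?_ ?_
  · intro x
    have hx := IsPrimitive.sum hS h x
    rw [hform, hx.integral_mul_eq_zero]
    have h1 : 0 ≤ ∫ s in (0 : ℝ)..1, (∑ j, x j * u j s) * (∑ i, x i * u i s) :=
      intervalIntegral.integral_nonneg zero_le_one fun s _ => mul_self_nonneg _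
    have h2 := hlow x
    simp only [sq (∑ j, x j * g j _)] at h2
    have := mul_nonneg hγ h1
    linarith
  · intro x y
    have hx := IsPrimitive.sum hS h x
    have hy := IsPrimitive.sum hS h y
    set X := √(∫ s in (0 : ℝ)..1, (∑ j, x j * g j s) ^ 2) with hX
    set Y := √(∫ s in (0 : ℝ)..1, (∑ j, y j * g j s) ^ 2) with hY
    have hX0 : 0 ≤ X := Real.sqrt_nonneg _
    have hY0 : 0 ≤ Y := Real.sqrt_nonneg _
    have hxx : IntervalIntegrable (fun s => (∑ j, x j * g j s) ^ 2) volume 0 1 := by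
      simpa [sq] using hx.mul hx
    have hyy : IntervalIntegrable (fun s => (∑ j, y j * g j s) ^ 2) volume 0 1 := by
      simpa [sq] using hy.mul hy
    have h1 : |∫ s in (0 : ℝ)..1, (∑ j, x j * g j s) * (∑ i, y i * g i s)| ≤ X * Y :=
      abs_integral_mul_le hxx (hx.mul hy) hyy
    have h2 : |∫ s in (0 : ℝ)..1, (∑ j, x j * g j s) * (∑ i, y i * u i s)| ≤ X * Y := by
      calc _ ≤ ∫ s in (0 : ℝ)..1, |(∑ j, x j * g j s) * (∑ i, y i * u i s)| :=
            intervalIntegral.abs_integral_le_integral_abs zero_le_one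
        _ ≤ ∫ s in (0 : ℝ)..1, |(∑ j, x j * g j s)| * Y := by
            refine intervalIntegral.integral_mono_on zero_le_one (hx.mul_right hy).abs
              (hx.intervalIntegrable.abs.mul_const _) fun s hs => ?_
            rw [abs_mul]
            exact mul_le_mul_of_nonneg_left (hy.abs_le hs) (abs_nonneg _)
        _ ≤ X * Y := by
            rw [intervalIntegral.integral_mul_const]
            exact mul_le_mul_of_nonneg_right (integral_abs_le_sqrt hx.intervalIntegrable hxx) hY0
    have h3 : |∫ s in (0 : ℝ)..1, (∑ j, x j * u j s) * (∑ i, y i * u i s)| ≤ X * Y := by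
      have := intervalIntegral.norm_integral_le_of_norm_le_const (a := (0 : ℝ)) (b := 1)
        (f := fun s => (∑ j, x j * u j s) * (∑ i, y i * u i s)) (C := X * Y) (by
          intro s hs
          rw [uIoc_of_le zero_le_one] at hs
          rw [norm_mul]
          exact mul_le_mul (hx.abs_le ⟨hs.1.le, hs.2⟩) (hy.abs_le ⟨hs.1.le, hs.2⟩)
            (norm_nonneg _) hX0)
      simpa using this
    have h4 : X * Y ≤ M * (√(∑ i, x i ^ 2) * √(∑ i, y i ^ 2)) := by
      have hXM : X ≤ √M * √(∑ i, x i ^ 2) := by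
        rw [← Real.sqrt_mul hM]; exact Real.sqrt_le_sqrt (hup x)
      have hYM : Y ≤ √M * √(∑ i, y i ^ 2) := by
        rw [← Real.sqrt_mul hM]; exact Real.sqrt_le_sqrt (hup y)
      calc X * Y ≤ (√M * √(∑ i, x i ^ 2)) * (√M * √(∑ i, y i ^ 2)) :=
            mul_le_mul hXM hYM hY0 (by positivity)
        _ = (√M * √M) * (√(∑ i, x i ^ 2) * √(∑ i, y i ^ 2)) := by ring
        _ = _ := by rw [Real.mul_self_sqrt hM]
    rw [hform]
    calc _ ≤ X * Y + |β| * (X * Y) + γ * (X * Y) := by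
          refine (abs_add_le _ _).trans (add_le_add ((abs_add_le _ _).trans (add_le_add h1 ?_)) ?_)
          · rw [abs_mul]; exact mul_le_mul_of_nonneg_left h2 (abs_nonneg _)
          · rw [abs_mul, abs_of_nonneg hγ]; exact mul_le_mul_of_nonneg_left h3 hγ
      _ = (1 + |β| + γ) * (X * Y) := by ring
      _ ≤ (1 + |β| + γ) * (M * (√(∑ i, x i ^ 2) * √(∑ i, y i ^ 2))) :=
          mul_le_mul_of_nonneg_left h4 (by positivity)
      _ = _ := by ring

end Galerkin

/-! ### Sign alternations -/

/-- There are points `a ≤ x₁ ≤ ⋯ ≤ x_r < 1` at which `f` has the strict signs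
`σ, -σ, σ, …`. -/
def Alternates (f : ℝ → ℝ) : ℕ → ℝ → ℝ → Prop
  | 0, _, _ => True
  | r + 1, σ, a => ∃ x, a ≤ x ∧ x < 1 ∧ 0 < σ * f x ∧ Alternates f r (-σ) x

theorem Alternates.mono {f : ℝ → ℝ} {r : ℕ} {σ a b : ℝ} (h : Alternates f r σ a) (hba : b ≤ a) :
    Alternates f r σ b := by
  cases r with
  | zero => trivial
  | succ r =>
    obtain ⟨x, h1, h2, h3, h4⟩ := h
    exact ⟨x, hba.trans h1, h2, h3, h4⟩

theorem exists_pos_of_integral_pos {g : ℝ → ℝ} {σ a b : ℝ} (hab : a ≤ b)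
    (h : 0 < σ * ∫ s in a..b, g s) : ∃ y ∈ Icc a b, 0 < σ * g y := by
  by_contra hc
  push Not at hc
  rw [← intervalIntegral.integral_const_mul] at h
  have : 0 ≤ ∫ s in a..b, -(σ * g s) :=
    intervalIntegral.integral_nonneg hab fun u hu => neg_nonneg.2 (hc u hu)
  rw [intervalIntegral.integral_neg] at this
  linarith

section Rolle

variable {f g : ℝ → ℝ} (hfg : ∀ x y, 0 ≤ x → x ≤ y → y < 1 → f y - f x = ∫ s in x..y, g s)

include hfg in
-- Between consecutive points where f has opposite signs its increment has the later sign, so g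
-- takes that sign somewhere between. The starting value σ f(a) ≤ 0 plays the role of a preceding
-- point, so no alternation is lost.
theorem Alternates.rolle {r : ℕ} : ∀ {σ a : ℝ}, 0 ≤ a → a < 1 → σ * f a ≤ 0 →
    Alternates f r σ a → Alternates g r σ a := by
  induction r with
  | zero => intros; trivial
  | succ r ih =>
    rintro σ a ha ha1 hσ ⟨x, hax, hx1, hx, h⟩
    have h1 : 0 < σ * ∫ s in a..x, g s := by
      rw [← hfg a x ha hax hx1, mul_sub]; linarith
    obtain ⟨y, hy, hgy⟩ := exists_pos_of_integral_pos hax h1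
    exact ⟨y, hy.1, hy.2.trans_lt hx1, hgy,
      (ih (ha.trans hax) hx1 (by linarith) h).mono hy.2⟩

include hfg in
-- One alternation is gained: after its last alternation f must return to 0 at the right end. The
-- assumption g(1) = 0 keeps the new point strictly left of 1, as `Alternates` demands.
theorem Alternates.rolle_of_end (hend : ∀ x, 0 ≤ x → x < 1 → - f x = ∫ s in x..1, g s)
    (hg1 : g 1 = 0) {r : ℕ} : ∀ {σ a : ℝ}, 0 ≤ a → a < 1 → σ * f a < 0 →
    Alternates f r σ a → Alternates g (r + 1) σ a := by
  induction r with
  | zero =>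
    intro σ a ha ha1 hσ _
    have h1 : 0 < σ * ∫ s in a..1, g s := by rw [← hend a ha ha1]; linarith
    obtain ⟨y, hy, hgy⟩ := exists_pos_of_integral_pos ha1.le h1
    refine ⟨y, hy.1, lt_of_le_of_ne hy.2 ?_, hgy, trivial⟩
    rintro rfl
    simp [hg1] at hgy
  | succ r ih =>
    rintro σ a ha ha1 hσ ⟨x, hax, hx1, hx, h⟩
    have h1 : 0 < σ * ∫ s in a..x, g s := by
      rw [← hfg a x ha hax hx1, mul_sub]; linarith
    obtain ⟨y, hy, hgy⟩ := exists_pos_of_integral_pos hax h1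
    exact ⟨y, hy.1, hy.2.trans_lt hx1, hgy,
      (ih (ha.trans hax) hx1 (by linarith) h).mono hy.2⟩

include hfg in
theorem Alternates.rolle_of_start_end (h0 : f 0 = 0)
    (hend : ∀ x, 0 ≤ x → x < 1 → - f x = ∫ s in x..1, g s)
    (hg1 : g 1 = 0) {r : ℕ} {σ : ℝ} (h : Alternates f (r + 1) σ 0) :
    Alternates g (r + 2) σ 0 := by
  obtain ⟨x, hax, hx1, hx, h⟩ := h
  have h1 : 0 < σ * ∫ s in (0 : ℝ)..x, g s := by
    rw [← hfg 0 x le_rfl hax hx1, h0, sub_zero]; exact hx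
  obtain ⟨y, hy, hgy⟩ := exists_pos_of_integral_pos hax h1
  exact ⟨y, hy.1, hy.2.trans_lt hx1, hgy,
    (Alternates.rolle_of_end hfg hend hg1 hax hx1 (by linarith) h).mono hy.2⟩

end Rolle

/-! ### An inverse inequality -/

/-- A self-improving bound: if `|g| ≤ M` implies `|g| ≤ A + M / 2`, then `|g| ≤ 2 A`. -/
theorem abs_le_of_absorb {s : Set ℝ} {g : ℝ → ℝ} {A M₀ : ℝ} (h0 : ∀ x ∈ s, |g x| ≤ M₀)
    (h : ∀ M, (∀ x ∈ s, |g x| ≤ M) → ∀ x ∈ s, |g x| ≤ A + M / 2) :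
    ∀ x ∈ s, |g x| ≤ 2 * A := by
  intro x hx
  have hbdd : BddAbove ((fun x => |g x|) '' s) := ⟨M₀, by rintro _ ⟨y, hy, rfl⟩; exact h0 y hy⟩
  have h1 : ∀ y ∈ s, |g y| ≤ sSup ((fun x => |g x|) '' s) := fun y hy =>
    le_csSup hbdd ⟨y, hy, rfl⟩
  have h2 : sSup ((fun x => |g x|) '' s) ≤ A + sSup ((fun x => |g x|) '' s) / 2 :=
    csSup_le ⟨_, x, hx, rfl⟩ (by rintro _ ⟨y, hy, rfl⟩; exact h _ h1 y hy)
  have := h1 x hx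
  linarith

/-- If `L ≤ (b - a) / 4`, then each point of `(a, b)` is an endpoint of a subinterval of length
`L`. -/
theorem exists_subinterval {a b x L : ℝ} (hx : x ∈ Ioo a b) (hL : 0 < L) (hLb : L ≤ (b - a) / 4) :
    ∃ u v, u ∈ Ioo a b ∧ v ∈ Ioo a b ∧ v - u = L ∧ x ∈ Icc u v := by
  rcases lt_or_ge (x + L) b with h | h
  · exact ⟨x, x + L, hx, ⟨by linarith [hx.1], h⟩, by ring, ⟨le_rfl, by linarith⟩⟩
  · exact ⟨x - L, x, ⟨by linarith [hx.1, hx.2], by linarith [hx.2]⟩, hx, by ring,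
      ⟨by linarith, le_rfl⟩⟩

/-- The mean of g over an interval of length L is at most 2B/L, and g deviates from it by at most C
N M L. With L = 1/(4CN) this reads |g| ≤ 8CNB + M/4, and the M-term is absorbed into the left side.
-/
theorem abs_le_of_integral_of_lipschitz {a b : ℝ} {f g : ℝ → ℝ} {B C N M₀ : ℝ}
    (hN : 0 < N) (hab : b - a = 1 / N) (hC : 1 ≤ C)
    (hf : ∀ x ∈ Ioo a b, |f x| ≤ B)
    (hfg : ∀ x ∈ Ioo a b, ∀ y ∈ Ioo a b, x ≤ y → f y - f x = ∫ s in x..y, g s)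
    (hint : ∀ x ∈ Ioo a b, ∀ y ∈ Ioo a b, IntervalIntegrable g volume x y)
    (h0 : ∀ x ∈ Ioo a b, |g x| ≤ M₀)
    (hg : ∀ M, (∀ x ∈ Ioo a b, |g x| ≤ M) → ∀ x ∈ Ioo a b, ∀ y ∈ Ioo a b,
      |g x - g y| ≤ C * N * M * |x - y|) :
    ∀ x ∈ Ioo a b, |g x| ≤ 16 * C * N * B := by
  have key : ∀ x ∈ Ioo a b, |g x| ≤ 2 * (8 * C * N * B) := by
    refine abs_le_of_absorb h0 fun M hM x hx => ?_
    have hM0 : 0 ≤ M := (abs_nonneg _).trans (hM x hx)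
    have hL : 0 < 1 / (4 * C * N) := by positivity
    have hLb : 1 / (4 * C * N) ≤ (b - a) / 4 := by
      rw [hab, div_div]
      apply one_div_le_one_div_of_le (by positivity)
      nlinarith
    obtain ⟨u, v, hu, hv, huv, hxuv⟩ := exists_subinterval hx hL hLb
    set L := 1 / (4 * C * N) with hLdef
    have huv' : u ≤ v := by linarith
    have h1 : ∫ s in u..v, (g x - g s) = L * g x - (f v - f u) := by
      rw [intervalIntegral.integral_sub (by simp) (hint u hu v hv), ← hfg u hu v hv huv']
      simp [huv]
    have h2 : ‖∫ s in u..v, (g x - g s)‖ ≤ (C * N * M * L) * |v - u| := by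
      refine intervalIntegral.norm_integral_le_of_norm_le_const fun s hs => ?_
      rw [uIoc_of_le huv'] at hs
      have hsI : s ∈ Ioo a b := ⟨hu.1.trans hs.1, hs.2.trans_lt hv.2⟩
      refine (hg M hM x hx s hsI).trans ?_
      refine mul_le_mul_of_nonneg_left ?_ (by positivity)
      rw [abs_le]
      constructor <;> linarith [hxuv.1, hxuv.2, hs.1, hs.2]
    rw [h1, huv, abs_of_pos hL, Real.norm_eq_abs] at h2
    have h3 : L * |g x| ≤ 2 * B + C * N * M * L * L := by
      have e : L * |g x| = |L * g x| := by rw [abs_mul, abs_of_pos hL]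
      rw [e]
      have h4 : |f v - f u| ≤ 2 * B := by
        have := abs_sub (f v) (f u)
        linarith [hf v hv, hf u hu]
      have h5 : |L * g x| ≤ |L * g x - (f v - f u)| + |f v - f u| := by
        have := abs_add_le (L * g x - (f v - f u)) (f v - f u)
        simpa using this
      linarith
    have hCL : 4 * C * N * L = 1 := by rw [hLdef]; field_simp
    have h6 : |g x| = 4 * C * N * (L * |g x|) := by
      rw [← mul_assoc, hCL, one_mul]
    rw [h6]
    have h7 : 4 * C * N * (L * |g x|) ≤ 4 * C * N * (2 * B + C * N * M * L * L) :=
      mul_le_mul_of_nonneg_left h3 (by positivity)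
    have h8 : 4 * C * N * (2 * B + C * N * M * L * L) = 8 * C * N * B + (4 * C * N * L) ^ 2 * M / 4 := by
      ring
    rw [hCL] at h8
    linarith
  intro x hx
  linarith [key x hx]

/-! ### Knots -/

section Knots

variable {n p : ℕ}

theorem knot_eq_min (hn : 1 ≤ n) (i : ℕ) :
    knot n p i = ((min (i - (p + 1)) n : ℕ) : ℝ) / n := by
  have hn0 : (n : ℝ) ≠ 0 := by positivity
  unfold knot
  split_ifs with h1 h2
  · rw [Nat.sub_eq_zero_of_le h1]; simp
  · rw [min_eq_left (by omega), Nat.cast_sub (by omega)]; push_cast; rfl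
  · rw [min_eq_right (by omega), div_self hn0]

theorem knot_mono (hn : 1 ≤ n) : Monotone (knot n p) := by
  intro i j hij
  rw [knot_eq_min hn, knot_eq_min hn]
  gcongr

theorem knot_nonneg (hn : 1 ≤ n) (i : ℕ) : 0 ≤ knot n p i := by
  rw [knot_eq_min hn]; positivity

theorem knot_le_one (hn : 1 ≤ n) (i : ℕ) : knot n p i ≤ 1 := by
  rw [knot_eq_min hn]
  exact div_le_one_of_le₀ (by exact_mod_cast min_le_right _ _) (by positivity)

theorem knot_eq_zero {i : ℕ} (h : i ≤ p + 1) : knot n p i = 0 := by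
  simp [knot, h]

theorem knot_eq_one (hn : 1 ≤ n) {i : ℕ} (h : p + n + 1 ≤ i) : knot n p i = 1 := by
  rw [knot, if_neg (by omega), if_neg (by omega)]

theorem knot_eq_div (hn : 1 ≤ n) {i : ℕ} (h1 : p + 1 ≤ i) (h2 : i ≤ p + n + 1) :
    knot n p i = ((i : ℝ) - (p + 1)) / n := by
  rw [knot_eq_min hn, min_eq_left (by omega), Nat.cast_sub h1]; push_cast; rfl

theorem knot_succ_sub (hn : 1 ≤ n) {J : ℕ} (h1 : p + 1 ≤ J) (h2 : J ≤ p + n) :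
    knot n p (J + 1) - knot n p J = 1 / n := by
  rw [knot_eq_div hn (by omega) (by omega), knot_eq_div hn h1 (by omega)]
  push_cast; ring

theorem knot_lt_succ (hn : 1 ≤ n) {J : ℕ} (h1 : p + 1 ≤ J) (h2 : J ≤ p + n) :
    knot n p J < knot n p (J + 1) := by
  have := knot_succ_sub hn h1 h2
  have h : (0 : ℝ) < 1 / n := by positivity
  linarith

theorem knot_add_sub_le (hn : 1 ≤ n) (i k : ℕ) :
    knot n p (i + k) - knot n p i ≤ k / n := by
  rw [knot_eq_min hn, knot_eq_min hn, ← sub_div]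
  gcongr
  rw [sub_le_iff_le_add]
  exact_mod_cast (by omega)

theorem exists_knot_interval (hn : 1 ≤ n) {x : ℝ} (h0 : 0 ≤ x) (h1 : x < 1) :
    ∃ J, p + 1 ≤ J ∧ J ≤ p + n ∧ knot n p J ≤ x ∧ x < knot n p (J + 1) := by
  have hn0 : (0 : ℝ) < n := by positivity
  have h2 : ⌊x * n⌋₊ < n := by
    rw [Nat.floor_lt (by positivity)]; nlinarith
  refine ⟨p + 1 + ⌊x * n⌋₊, by omega, by omega, ?_, ?_⟩
  · rw [knot_eq_div hn (by omega) (by omega), div_le_iff₀ hn0]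
    push_cast
    have := Nat.floor_le (by positivity : 0 ≤ x * n)
    linarith
  · rw [knot_eq_div hn (by omega) (by omega), lt_div_iff₀ hn0]
    push_cast
    have := Nat.lt_floor_add_one (x * n)
    linarith

theorem knot_eq_iff (hn : 1 ≤ n) {i k : ℕ} (hk : 1 ≤ k) :
    knot n p i = knot n p (i + k + 1) ↔ ¬ (p + 1 ≤ i + k ∧ i ≤ p + n) := by
  constructor
  · rintro h ⟨h1, h2⟩
    -- The index max(i, p + 1) starts a knot interval of positive length inside the support.
    have h3 := knot_lt_succ (p := p) hn (J := max i (p + 1)) (by omega) (by omega)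
    have h4 : knot n p i ≤ knot n p (max i (p + 1)) := knot_mono hn (by omega)
    have h5 : knot n p (max i (p + 1) + 1) ≤ knot n p (i + k + 1) := knot_mono hn (by omega)
    linarith
  · intro h
    by_cases h1 : p + 1 ≤ i + k
    · rw [knot_eq_one hn (by omega), knot_eq_one hn (by omega)]
    · rw [knot_eq_zero (by omega), knot_eq_zero (by omega)]

end Knots

/-! ### Splines with given coefficients -/

theorem integral_eq_zero_of_Ioo {f : ℝ → ℝ} {a b : ℝ} (hab : a ≤ b)
    (h : ∀ x ∈ Ioo a b, f x = 0) : ∫ x in a..b, f x = 0 := by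
  rw [intervalIntegral.integral_of_le hab, integral_Ioc_eq_integral_Ioo]
  exact setIntegral_eq_zero_of_forall_eq_zero h

/-- The spline of degree `k` with coefficients `c`. -/
noncomputable def spl (Q : Kind) (θ : ℝ) (n p k : ℕ) (c : ℕ → ℝ) (x : ℝ) : ℝ :=
  ∑ i ∈ Finset.range (p + n + 1), c i * gbSpline Q θ (knot n p) k i x

/-- The integral of a GB-spline. -/
noncomputable def mass (Q : Kind) (θ : ℝ) (n p k i : ℕ) : ℝ :=
  ∫ x in (0 : ℝ)..1, gbSpline Q θ (knot n p) k i x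

/-- The coefficients in degree `k` of the derivative of the spline of degree `k + 1` with
coefficients `c`. -/
noncomputable def dcoef (Q : Kind) (θ : ℝ) (n p k : ℕ) (c : ℕ → ℝ) (i : ℕ) : ℝ :=
  (c i - c (i - 1)) / mass Q θ n p k i

/-- The GB-splines of degree `k` are supported between their knots, bounded by `C`, and form a basis
on each knot interval that is stable, and whose elements have Lipschitz constants of order `n`,
uniformly with constant `C`; moreover a spline with alternating coefficients has no
alternations of the opposite sign. -/
structure Regular (Q : Kind) (θ : ℝ) (n p k : ℕ) (C : ℝ) : Prop where
  one_le : 1 ≤ C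
  measurable : ∀ i, Measurable (gbSpline Q θ (knot n p) k i)
  eq_zero : ∀ i x, 0 ≤ x → (x < knot n p i ∨ knot n p (i + k + 1) ≤ x) →
    gbSpline Q θ (knot n p) k i x = 0
  sum_le : ∀ x, 0 ≤ x → ∑ i ∈ Finset.range (p + n + 1), gbSpline Q θ (knot n p) k i x ≤ C
  stable : ∀ J c B, p + 1 ≤ J → J ≤ p + n →
    (∀ x ∈ Ioo (knot n p J) (knot n p (J + 1)), |spl Q θ n p k c x| ≤ B) →
    ∀ i, J ≤ i + k → i ≤ J → |c i| ≤ C * B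
  lipschitz : ∀ J c B, p + 1 ≤ J → J ≤ p + n →
    (∀ x ∈ Ioo (knot n p J) (knot n p (J + 1)), |spl Q θ n p k c x| ≤ B) →
    ∀ x ∈ Ioo (knot n p J) (knot n p (J + 1)), ∀ y ∈ Ioo (knot n p J) (knot n p (J + 1)),
      |spl Q θ n p k c x - spl Q θ n p k c y| ≤ C * n * B * |x - y|
  alternates : ∀ (a b : ℕ) (ε : ℝ) (c : ℕ → ℝ), a < b → p + 1 ≤ a + k → b ≤ p + n + 1 →
    (∀ i, i < a ∨ b ≤ i → c i = 0) →
    (∀ i, a ≤ i → i < b → 0 < ε * (-1) ^ i * c i) →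
    ¬ Alternates (spl Q θ n p k c) (b - a) (-(ε * (-1) ^ a)) 0

section Spl

variable {Q : Kind} {θ : ℝ} {n p k : ℕ} {C : ℝ}

theorem spl_single {i : ℕ} (hi : i ≤ p + n) (x : ℝ) :
    spl Q θ n p k (Pi.single i 1) x = gbSpline Q θ (knot n p) k i x := by
  rw [spl, Finset.sum_eq_single i]
  · simp
  · intro j _ hj; simp [hj]
  · intro h; simp at h; omega

theorem gbSpline_eq_zero_of_degenerate
    (h0 : ∀ i x, 0 ≤ x → (x < knot n p i ∨ knot n p (i + k + 1) ≤ x) →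
      gbSpline Q θ (knot n p) k i x = 0) (hn : 1 ≤ n) {i : ℕ}
    (hk : 1 ≤ k) (hi : ¬ (p + 1 ≤ i + k ∧ i ≤ p + n)) {x : ℝ} (hx : 0 ≤ x) :
    gbSpline Q θ (knot n p) k i x = 0 := by
  rw [← knot_eq_iff hn hk] at hi
  refine h0 i x hx ?_
  rw [← hi]
  exact lt_or_ge _ _

theorem Regular.eq_zero_of_degenerate (h : Regular Q θ n p k C) (hn : 1 ≤ n) {i : ℕ}
    (hk : 1 ≤ k) (hi : ¬ (p + 1 ≤ i + k ∧ i ≤ p + n)) {x : ℝ} (hx : 0 ≤ x) :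
    gbSpline Q θ (knot n p) k i x = 0 :=
  gbSpline_eq_zero_of_degenerate h.eq_zero hn hk hi hx

theorem Regular.mass_eq_zero (h : Regular Q θ n p k C) (hn : 1 ≤ n) {i : ℕ}
    (hk : 1 ≤ k) (hi : ¬ (p + 1 ≤ i + k ∧ i ≤ p + n)) : mass Q θ n p k i = 0 :=
  integral_eq_zero_of_Ioo zero_le_one fun _ hx => h.eq_zero_of_degenerate hn hk hi hx.1.le

/-- A single basis function has one nonzero coefficient, and a negative value would be one
alternation of the forbidden sign. The two needed properties are taken as separate hypotheses
because the lemma is also applied in degree k + 1 before `Regular` is available there. -/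
theorem gbSpline_nonneg
    (h0 : ∀ i x, 0 ≤ x → (x < knot n p i ∨ knot n p (i + k + 1) ≤ x) →
      gbSpline Q θ (knot n p) k i x = 0)
    (h1 : ∀ (a b : ℕ) (ε : ℝ) (c : ℕ → ℝ), a < b → p + 1 ≤ a + k → b ≤ p + n + 1 →
      (∀ i, i < a ∨ b ≤ i → c i = 0) → (∀ i, a ≤ i → i < b → 0 < ε * (-1) ^ i * c i) →
      ¬ Alternates (spl Q θ n p k c) (b - a) (-(ε * (-1) ^ a)) 0)
    (hn : 1 ≤ n) (hk : 1 ≤ k) (i : ℕ) {x : ℝ}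
    (hx : 0 ≤ x) : 0 ≤ gbSpline Q θ (knot n p) k i x := by
  by_cases hi : p + 1 ≤ i + k ∧ i ≤ p + n
  · by_contra hc
    push Not at hc
    have hx1 : x < 1 := by
      by_contra h1'
      push Not at h1'
      rw [h0 i x hx (Or.inr ((knot_le_one hn _).trans h1'))] at hc
      exact lt_irrefl _ hc
    have he : ∀ j : ℕ, ((-1 : ℝ) ^ j) * (-1) ^ j = 1 := fun j => by
      rw [← mul_pow]; norm_num
    -- The choice ε = (-1)^i cancels the sign attached to index i.
    refine h1 i (i + 1) ((-1) ^ i) (Pi.single i 1) (by omega) hi.1 (by omega) ?_ ?_ ?_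
    · intro j hj
      rw [Pi.single_eq_of_ne (by omega)]
    · intro j hj1 hj2
      obtain rfl : j = i := by omega
      rw [he]; simp
    · rw [Nat.add_sub_cancel_left]
      refine ⟨x, hx, hx1, ?_, trivial⟩
      rw [he, spl_single hi.2]
      linarith
  · exact (gbSpline_eq_zero_of_degenerate h0 hn hk hi hx).ge

theorem Regular.nonneg (h : Regular Q θ n p k C) (hn : 1 ≤ n) (hk : 1 ≤ k) (i : ℕ) {x : ℝ}
    (hx : 0 ≤ x) : 0 ≤ gbSpline Q θ (knot n p) k i x :=
  gbSpline_nonneg h.eq_zero h.alternates hn hk i hx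

theorem Regular.le (h : Regular Q θ n p k C) (hn : 1 ≤ n) (hk : 1 ≤ k) (i : ℕ) {x : ℝ}
    (hx : 0 ≤ x) : gbSpline Q θ (knot n p) k i x ≤ C := by
  by_cases hi : i ∈ Finset.range (p + n + 1)
  · exact (Finset.single_le_sum (f := fun i => gbSpline Q θ (knot n p) k i x)
      (fun j _ => h.nonneg hn hk j hx) hi).trans (h.sum_le x hx)
  · rw [h.eq_zero_of_degenerate hn hk (by simp at hi; omega) hx]
    linarith [h.one_le]

theorem Regular.intervalIntegrable (h : Regular Q θ n p k C) (hn : 1 ≤ n) (hk : 1 ≤ k) (i : ℕ)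
    {a b : ℝ} (ha : 0 ≤ a) (hb : 0 ≤ b) :
    IntervalIntegrable (gbSpline Q θ (knot n p) k i) volume a b := by
  refine intervalIntegrable_of_abs_le (h.measurable i) (C := C) fun x hx => ?_
  have hx0 : 0 ≤ x := (le_min ha hb).trans hx.1
  rw [abs_of_nonneg (h.nonneg hn hk i hx0)]
  exact h.le hn hk i hx0

theorem Regular.spl_measurable (h : Regular Q θ n p k C) (c : ℕ → ℝ) :
    Measurable (spl Q θ n p k c) :=
  Finset.measurable_sum _ fun i _ => (h.measurable i).const_mul _

theorem Regular.abs_spl_le (h : Regular Q θ n p k C) (hn : 1 ≤ n) (hk : 1 ≤ k) (c : ℕ → ℝ)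
    {x : ℝ} (hx : 0 ≤ x) :
    |spl Q θ n p k c x| ≤ ∑ i ∈ Finset.range (p + n + 1), |c i| * C := by
  refine (Finset.abs_sum_le_sum_abs _ _).trans (Finset.sum_le_sum fun i _ => ?_)
  rw [abs_mul, abs_of_nonneg (h.nonneg hn hk i hx)]
  exact mul_le_mul_of_nonneg_left (h.le hn hk i hx) (abs_nonneg _)

theorem Regular.spl_intervalIntegrable (h : Regular Q θ n p k C) (hn : 1 ≤ n) (hk : 1 ≤ k)
    (c : ℕ → ℝ) {a b : ℝ} (ha : 0 ≤ a) (hb : 0 ≤ b) :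
    IntervalIntegrable (spl Q θ n p k c) volume a b :=
  intervalIntegrable_of_abs_le (h.spl_measurable c) fun _ hx =>
    h.abs_spl_le hn hk c ((le_min ha hb).trans hx.1)

theorem Regular.spl_eq_zero (h : Regular Q θ n p k C) (hn : 1 ≤ n) (c : ℕ → ℝ)
    {x : ℝ} (hx : 1 ≤ x) : spl Q θ n p k c x = 0 :=
  Finset.sum_eq_zero fun i _ => by
    rw [h.eq_zero i x (by linarith) (Or.inr ((knot_le_one hn _).trans hx)), mul_zero]

theorem Regular.mass_le (h : Regular Q θ n p k C) (hn : 1 ≤ n) (hk : 1 ≤ k) (i : ℕ) :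
    mass Q θ n p k i ≤ C * (k + 1) / n := by
  have h0 := knot_nonneg (n := n) (p := p) hn i
  have h1 := knot_le_one (n := n) (p := p) hn (i + k + 1)
  have h2 : knot n p i ≤ knot n p (i + k + 1) := knot_mono hn (by omega)
  have hi := fun {a b} => h.intervalIntegrable hn hk i (a := a) (b := b)
  have e1 : ∫ x in (0 : ℝ)..knot n p i, gbSpline Q θ (knot n p) k i x = 0 :=
    integral_eq_zero_of_Ioo h0 fun x hx => h.eq_zero i x hx.1.le (Or.inl hx.2)
  have e2 : ∫ x in (knot n p (i + k + 1))..1, gbSpline Q θ (knot n p) k i x = 0 :=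
    integral_eq_zero_of_Ioo h1 fun x hx =>
      h.eq_zero i x ((h0.trans h2).trans hx.1.le) (Or.inr hx.1.le)
  rw [mass, ← intervalIntegral.integral_add_adjacent_intervals
      (hi le_rfl (h0.trans h2)) (hi (h0.trans h2) zero_le_one),
    ← intervalIntegral.integral_add_adjacent_intervals (hi le_rfl h0) (hi h0 (h0.trans h2)), e1, e2,
    zero_add, add_zero]
  calc _ ≤ ∫ x in (knot n p i)..(knot n p (i + k + 1)), C :=
        intervalIntegral.integral_mono_on h2 (hi h0 (h0.trans h2)) (by simp)
          fun x hx => h.le hn hk i (h0.trans hx.1)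
    _ = (knot n p (i + (k + 1)) - knot n p i) * C := by simp [add_assoc]
    _ ≤ ((k + 1 : ℕ) / n) * C :=
        mul_le_mul_of_nonneg_right (knot_add_sub_le hn _ _) (by linarith [h.one_le])
    _ = _ := by push_cast; ring

/-- Stability forces the spline to exceed 1/(2C) somewhere on a knot interval of its support, and
the Lipschitz bound C² n keeps it above 1/(4C) on a subinterval of length 1/(4C³n). -/
theorem Regular.le_mass (h : Regular Q θ n p k C) (hn : 1 ≤ n) (hk : 1 ≤ k) {i : ℕ}
    (h1 : p + 1 ≤ i + k) (h2 : i ≤ p + n) :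
    1 / (16 * C ^ 4 * n) ≤ mass Q θ n p k i := by
  have hC := h.one_le
  have hC0 : 0 < C := by linarith
  have hn0 : (1 : ℝ) ≤ n := by exact_mod_cast hn
  set J := max i (p + 1) with hJ
  have hJ1 : p + 1 ≤ J := by omega
  have hJ2 : J ≤ p + n := by omega
  have hI0 : 0 ≤ knot n p J := knot_nonneg hn J
  have hI1 : knot n p (J + 1) ≤ 1 := knot_le_one hn _
  obtain ⟨x, hx, hNx⟩ : ∃ x ∈ Ioo (knot n p J) (knot n p (J + 1)),
      1 / (2 * C) < gbSpline Q θ (knot n p) k i x := by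
    by_contra hc
    push Not at hc
    -- If the spline stayed below 1/(2C), stability would bound its coefficient 1 by 1/2.
    have := h.stable J (Pi.single i 1) (1 / (2 * C)) hJ1 hJ2 (fun x hx => by
      rw [spl_single h2, abs_of_nonneg (h.nonneg hn hk i (hI0.trans hx.1.le))]
      exact hc x hx) i (by omega) (by omega)
    have e : C * (1 / (2 * C)) = 1 / 2 := by field_simp
    rw [e] at this
    norm_num at this
  have hL : 0 < 1 / (4 * C ^ 3 * n) := by positivity
  have hLb : 1 / (4 * C ^ 3 * n) ≤ (knot n p (J + 1) - knot n p J) / 4 := by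
    rw [knot_succ_sub hn hJ1 hJ2, div_div]
    apply one_div_le_one_div_of_le (by positivity)
    have : 1 ≤ C ^ 3 := one_le_pow₀ hC
    nlinarith
  obtain ⟨u, v, hu, hv, huv, hxuv⟩ := exists_subinterval hx hL hLb
  have huv' : u ≤ v := by linarith
  have hu0 : 0 ≤ u := hI0.trans hu.1.le
  have hv0 : 0 ≤ v := hI0.trans hv.1.le
  have hlow : ∀ y ∈ Icc u v, 1 / (4 * C) ≤ gbSpline Q θ (knot n p) k i y := by
    intro y hy
    have hyI : y ∈ Ioo (knot n p J) (knot n p (J + 1)) :=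
      ⟨hu.1.trans_le hy.1, hy.2.trans_lt hv.2⟩
    have := h.lipschitz J (Pi.single i 1) C hJ1 hJ2 (fun x hx => by
      rw [spl_single h2, abs_of_nonneg (h.nonneg hn hk i (hI0.trans hx.1.le))]
      exact h.le hn hk i (hI0.trans hx.1.le)) x hx y hyI
    rw [spl_single h2, spl_single h2] at this
    have hxy : |x - y| ≤ 1 / (4 * C ^ 3 * n) := by
      rw [abs_le]; constructor <;> linarith [hxuv.1, hxuv.2, hy.1, hy.2]
    have h3 : C * n * C * |x - y| ≤ C * n * C * (1 / (4 * C ^ 3 * n)) :=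
      mul_le_mul_of_nonneg_left hxy (by positivity)
    have h4 : C * n * C * (1 / (4 * C ^ 3 * n)) = 1 / (4 * C) := by field_simp
    have h5 : 1 / (2 * C) = 1 / (4 * C) + 1 / (4 * C) := by field_simp; norm_num
    have := le_abs_self (gbSpline Q θ (knot n p) k i x - gbSpline Q θ (knot n p) k i y)
    linarith
  have hi := fun {a b} => h.intervalIntegrable hn hk i (a := a) (b := b)
  calc 1 / (16 * C ^ 4 * n) = ∫ _ in u..v, 1 / (4 * C) := by
        rw [intervalIntegral.integral_const, huv, smul_eq_mul]; field_simp; norm_num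
    _ ≤ ∫ y in u..v, gbSpline Q θ (knot n p) k i y :=
        intervalIntegral.integral_mono_on huv' (by simp) (hi hu0 hv0) hlow
    _ ≤ mass Q θ n p k i := by
        refine intervalIntegral.integral_mono_interval hu0 huv' (hv.2.le.trans hI1) ?_
          (hi le_rfl zero_le_one)
        filter_upwards [ae_restrict_mem measurableSet_Ioc] with y hy
        exact h.nonneg hn hk i hy.1.le

theorem Regular.mass_pos (h : Regular Q θ n p k C) (hn : 1 ≤ n) (hk : 1 ≤ k) {i : ℕ}
    (h1 : p + 1 ≤ i + k) (h2 : i ≤ p + n) : 0 < mass Q θ n p k i := by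
  have hC := h.one_le
  exact lt_of_lt_of_le (by positivity) (h.le_mass hn hk h1 h2)

end Spl

/-! ### From degree `k` to degree `k + 1` -/

/-- Summation by parts. With truncated subtraction the term i = 0 contributes nothing on the right,
which is why c 0 * P 0 appears separately. -/
theorem sum_mul_sub_succ (c P : ℕ → ℝ) (M : ℕ) :
    ∑ i ∈ Finset.range M, c i * (P i - P (i + 1)) =
      (∑ i ∈ Finset.range M, (c i - c (i - 1)) * P i) + c 0 * P 0 - c (M - 1) * P M := by
  induction M with
  | zero => simp
  | succ M ih => rw [Finset.sum_range_succ, ih, Finset.sum_range_succ, Nat.add_sub_cancel]; ring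

/-- The primitive is a parameter integral of a jointly measurable integrand, so no integrability of
f is needed. -/
theorem measurable_integral_zero {f : ℝ → ℝ} (hf : Measurable f) :
    Measurable fun x => ∫ s in (0 : ℝ)..x, f s := by
  simp only [intervalIntegral, ← integral_indicator measurableSet_Ioc]
  have key : ∀ S : Set (ℝ × ℝ), MeasurableSet S →
      Measurable fun x => ∫ s, S.indicator (fun q => f q.2) (x, s) := by
    intro S hS
    have h1 : StronglyMeasurable (S.indicator fun q : ℝ × ℝ => f q.2) :=
      ((hf.comp measurable_snd).indicator hS).stronglyMeasurable
    exact h1.integral_prod_right'.measurable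
  refine Measurable.sub (key {q | 0 < q.2 ∧ q.2 ≤ q.1} ?_) (key {q | q.1 < q.2 ∧ q.2 ≤ 0} ?_)
  · exact (measurableSet_lt measurable_const measurable_snd).inter
      (measurableSet_le measurable_snd measurable_fst)
  · exact (measurableSet_lt measurable_fst measurable_snd).inter
      (measurableSet_le measurable_snd measurable_const)

section Succ

variable {Q : Kind} {θ : ℝ} {n p k : ℕ} {C : ℝ}

/-- The normalized primitives of the GB-splines of degree `k`. -/
noncomputable def primitive (Q : Kind) (θ : ℝ) (n p k i : ℕ) (x : ℝ) : ℝ :=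
  normPrimitive (gbSpline Q θ (knot n p) k i) (knot n p i) (knot n p (i + k + 1)) x

theorem gbSpline_succ (hk : 1 ≤ k) (i : ℕ) (x : ℝ) :
    gbSpline Q θ (knot n p) (k + 1) i x =
      primitive Q θ n p k i x - primitive Q θ n p k (i + 1) x := by
  obtain ⟨k, rfl⟩ := Nat.exists_eq_add_of_le' hk
  have e : i + 1 + (k + 1) + 1 = i + k + 3 := by omega
  unfold primitive
  rw [e]
  rfl

theorem primitive_of_degenerate (hn : 1 ≤ n) (hk : 1 ≤ k) {i : ℕ}
    (hi : ¬ (p + 1 ≤ i + k ∧ i ≤ p + n)) (x : ℝ) :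
    primitive Q θ n p k i x = if knot n p (i + k + 1) ≤ x then 1 else 0 := by
  rw [primitive, normPrimitive, if_pos ((knot_eq_iff hn hk).2 hi)]

theorem primitive_of_nondegenerate (hn : 1 ≤ n) (hk : 1 ≤ k) {i : ℕ}
    (hi : p + 1 ≤ i + k ∧ i ≤ p + n) (x : ℝ) :
    primitive Q θ n p k i x =
      (∫ s in (0 : ℝ)..x, gbSpline Q θ (knot n p) k i s) / mass Q θ n p k i := by
  rw [primitive, normPrimitive, if_neg (fun h => (knot_eq_iff hn hk).1 h hi)]
  rfl

theorem Regular.primitive_eq_zero (h : Regular Q θ n p k C) (hn : 1 ≤ n) (hk : 1 ≤ k) {i : ℕ}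
    {x : ℝ} (hx : 0 ≤ x) (hxi : x < knot n p i) : primitive Q θ n p k i x = 0 := by
  by_cases hi : p + 1 ≤ i + k ∧ i ≤ p + n
  · rw [primitive_of_nondegenerate hn hk hi, integral_eq_zero_of_Ioo hx, zero_div]
    exact fun s hs => h.eq_zero i s hs.1.le (Or.inl (hs.2.trans hxi))
  · rw [primitive_of_degenerate hn hk hi, if_neg]
    rw [← (knot_eq_iff hn hk).2 hi]
    exact not_le.2 hxi

theorem Regular.primitive_eq_one (h : Regular Q θ n p k C) (hn : 1 ≤ n) (hk : 1 ≤ k) {i : ℕ}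
    {x : ℝ} (hx : 0 ≤ x) (hxi : knot n p (i + k + 1) ≤ x) : primitive Q θ n p k i x = 1 := by
  by_cases hi : p + 1 ≤ i + k ∧ i ≤ p + n
  · have hint := fun {a b} => h.intervalIntegrable hn hk i (a := a) (b := b)
    have e : ∫ s in (0 : ℝ)..x, gbSpline Q θ (knot n p) k i s = mass Q θ n p k i := by
      rw [mass, ← sub_eq_zero,
        intervalIntegral.integral_interval_sub_left (hint le_rfl hx) (hint le_rfl zero_le_one)]
      have hz : ∀ s, knot n p (i + k + 1) ≤ s → gbSpline Q θ (knot n p) k i s = 0 := fun s hs =>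
        h.eq_zero i s ((knot_nonneg hn _).trans hs) (Or.inr hs)
      rcases le_total 1 x with h1 | h1
      · exact integral_eq_zero_of_Ioo h1 fun s hs => hz s ((knot_le_one hn _).trans hs.1.le)
      · rw [intervalIntegral.integral_symm, integral_eq_zero_of_Ioo h1, neg_zero]
        exact fun s hs => hz s (hxi.trans hs.1.le)
    rw [primitive_of_nondegenerate hn hk hi, e, div_self (h.mass_pos hn hk hi.1 hi.2).ne']
  · rw [primitive_of_degenerate hn hk hi, if_pos hxi]

/-- In the degenerate case the right side is 0 by division by zero. A step at 0 is constant on [0,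
∞), while a step at 1 is constant only on [0, 1); the last hypothesis excludes that jump. -/
theorem Regular.primitive_sub (h : Regular Q θ n p k C) (hn : 1 ≤ n) (hk : 1 ≤ k) {i : ℕ}
    {x y : ℝ} (hx : 0 ≤ x) (hxy : x ≤ y) (hy : y < 1 ∨ i ≤ p + n) :
    primitive Q θ n p k i y - primitive Q θ n p k i x =
      (∫ s in x..y, gbSpline Q θ (knot n p) k i s) / mass Q θ n p k i := by
  by_cases hi : p + 1 ≤ i + k ∧ i ≤ p + n
  · have hint := fun {a b} => h.intervalIntegrable hn hk i (a := a) (b := b)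
    rw [primitive_of_nondegenerate hn hk hi, primitive_of_nondegenerate hn hk hi, ← sub_div,
      intervalIntegral.integral_interval_sub_left (hint le_rfl (hx.trans hxy)) (hint le_rfl hx)]
  · rw [h.mass_eq_zero hn hk hi, div_zero, primitive_of_degenerate hn hk hi,
      primitive_of_degenerate hn hk hi]
    by_cases h1 : p + 1 ≤ i + k
    · rw [knot_eq_one hn (by omega)]
      have hy1 : y < 1 := by
        rcases hy with hy | hy
        · exact hy
        · exact absurd ⟨h1, hy⟩ hi
      rw [if_neg (by linarith), if_neg (by linarith), sub_zero]
    · rw [knot_eq_zero (by omega), if_pos (hx.trans hxy), if_pos hx, sub_self]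

theorem Regular.gbSpline_succ_sub (h : Regular Q θ n p k C) (hn : 1 ≤ n) (hk : 1 ≤ k) {i : ℕ}
    {x y : ℝ} (hx : 0 ≤ x) (hxy : x ≤ y) (hy : y < 1 ∨ i + 1 ≤ p + n) :
    gbSpline Q θ (knot n p) (k + 1) i y - gbSpline Q θ (knot n p) (k + 1) i x =
      (∫ s in x..y, gbSpline Q θ (knot n p) k i s) / mass Q θ n p k i -
      (∫ s in x..y, gbSpline Q θ (knot n p) k (i + 1) s) / mass Q θ n p k (i + 1) := by
  rw [← h.primitive_sub hn hk hx hxy (hy.imp_right fun h => by omega),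
    ← h.primitive_sub hn hk hx hxy hy, gbSpline_succ hk, gbSpline_succ hk]
  ring

theorem Regular.integral_spl (h : Regular Q θ n p k C) (hn : 1 ≤ n) (hk : 1 ≤ k) (d : ℕ → ℝ)
    {x y : ℝ} (hx : 0 ≤ x) (hy : 0 ≤ y) :
    ∫ s in x..y, spl Q θ n p k d s =
      ∑ i ∈ Finset.range (p + n + 1), d i * ∫ s in x..y, gbSpline Q θ (knot n p) k i s := by
  unfold spl
  rw [intervalIntegral.integral_finsetSum fun i _ =>
    (h.intervalIntegrable hn hk i hx hy).const_mul _]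
  simp only [intervalIntegral.integral_const_mul]

theorem Regular.integral_dcoef (h : Regular Q θ n p k C) (hn : 1 ≤ n) (hk : 1 ≤ k) (hkp : k ≤ p)
    (c : ℕ → ℝ) {x y : ℝ} (hx : 0 ≤ x) (hxy : x ≤ y) :
    ∫ s in x..y, spl Q θ n p k (dcoef Q θ n p k c) s =
      ∑ i ∈ Finset.range (p + n + 1), c i *
        ((∫ s in x..y, gbSpline Q θ (knot n p) k i s) / mass Q θ n p k i -
        (∫ s in x..y, gbSpline Q θ (knot n p) k (i + 1) s) / mass Q θ n p k (i + 1)) := by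
  -- The boundary terms of the summation by parts vanish because the splines at indices 0 and p + n
  -- + 1 are degenerate and quotients by their zero mass are 0.
  rw [h.integral_spl hn hk _ hx (hx.trans hxy), sum_mul_sub_succ c
    (fun i => (∫ s in x..y, gbSpline Q θ (knot n p) k i s) / mass Q θ n p k i),
    h.mass_eq_zero hn hk (i := 0) (by omega), h.mass_eq_zero hn hk (i := p + n + 1) (by omega)]
  simp only [div_zero, mul_zero, add_zero, sub_zero]
  refine Finset.sum_congr rfl fun i _ => ?_
  rw [dcoef]; ring

/-- Derivative formula for splines in integrated form. Up to y = 1 it requires the coefficients from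
index p + n on to vanish, since splines are set to 0 at 1 and the last basis function would jump
there. -/
theorem Regular.spl_succ_sub (h : Regular Q θ n p k C) (hn : 1 ≤ n) (hk : 1 ≤ k) (hkp : k ≤ p)
    (c : ℕ → ℝ) {x y : ℝ} (hx : 0 ≤ x) (hxy : x ≤ y) (hy : y < 1 ∨ ∀ i, p + n ≤ i → c i = 0) :
    spl Q θ n p (k + 1) c y - spl Q θ n p (k + 1) c x =
      ∫ s in x..y, spl Q θ n p k (dcoef Q θ n p k c) s := by
  rw [h.integral_dcoef hn hk hkp c hx hxy, spl, spl, ← Finset.sum_sub_distrib]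
  refine Finset.sum_congr rfl fun i _ => ?_
  by_cases hc : c i = 0
  · simp [hc]
  · rw [← mul_sub, h.gbSpline_succ_sub hn hk hx hxy]
    refine hy.imp_right fun h => ?_
    by_contra hi
    exact hc (h i (by omega))

theorem Regular.gbSpline_succ_eq_zero (h : Regular Q θ n p k C) (hn : 1 ≤ n) (hk : 1 ≤ k)
    (i : ℕ) {x : ℝ} (hx : 0 ≤ x) (hxi : x < knot n p i ∨ knot n p (i + (k + 1) + 1) ≤ x) :
    gbSpline Q θ (knot n p) (k + 1) i x = 0 := by
  rw [gbSpline_succ hk]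
  rcases hxi with hxi | hxi
  · rw [h.primitive_eq_zero hn hk hx hxi, h.primitive_eq_zero hn hk hx
      (hxi.trans_le (knot_mono hn (by omega))), sub_zero]
  · rw [h.primitive_eq_one hn hk hx ((knot_mono hn (by omega)).trans hxi),
      h.primitive_eq_one hn hk hx ((knot_mono hn (by omega)).trans hxi), sub_self]

theorem Regular.sum_gbSpline_succ (h : Regular Q θ n p k C) (hn : 1 ≤ n) (hk : 1 ≤ k)
    (hkp : k ≤ p) {x : ℝ} (hx : 0 ≤ x) (hx1 : x < 1) :
    ∑ i ∈ Finset.range (p + n + 1), gbSpline Q θ (knot n p) (k + 1) i x = 1 := by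
  simp_rw [gbSpline_succ hk]
  rw [Finset.sum_range_sub', h.primitive_eq_one hn hk hx, h.primitive_eq_zero hn hk hx, sub_zero]
  · rw [knot_eq_one hn (by omega)]; exact hx1
  · rw [knot_eq_zero (by omega)]; exact hx

theorem Regular.sum_gbSpline_succ_le (h : Regular Q θ n p k C) (hn : 1 ≤ n) (hk : 1 ≤ k)
    (hkp : k ≤ p) {x : ℝ} (hx : 0 ≤ x) :
    ∑ i ∈ Finset.range (p + n + 1), gbSpline Q θ (knot n p) (k + 1) i x ≤ 1 := by
  rcases lt_or_ge x 1 with h1 | h1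
  · exact (h.sum_gbSpline_succ hn hk hkp hx h1).le
  · rw [Finset.sum_eq_zero fun i _ =>
      h.gbSpline_succ_eq_zero hn hk i hx (Or.inr ((knot_le_one hn _).trans h1))]
    exact zero_le_one

theorem Regular.measurable_succ (h : Regular Q θ n p k C) (hn : 1 ≤ n) (hk : 1 ≤ k) (i : ℕ) :
    Measurable (gbSpline Q θ (knot n p) (k + 1) i) := by
  have key : ∀ j, Measurable (primitive Q θ n p k j) := by
    intro j
    by_cases hj : p + 1 ≤ j + k ∧ j ≤ p + n
    · rw [show primitive Q θ n p k j = _ from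
        funext fun x => primitive_of_nondegenerate hn hk hj x]
      exact (measurable_integral_zero (h.measurable j)).div_const _
    · rw [show primitive Q θ n p k j = _ from funext fun x => primitive_of_degenerate hn hk hj x]
      exact Measurable.ite measurableSet_Ici measurable_const measurable_const
  rw [show gbSpline Q θ (knot n p) (k + 1) i = _ from funext fun x => gbSpline_succ hk i x]
  exact (key _).sub (key _)

/-- Differences of alternating coefficients alternate, with one index more, and Rolle gives the
derivative one more alternation when f vanishes at both ends. At an end where f need not vanish,
Rolle gives one fewer; but the extra derivative coefficient there belongs to a degenerate spline and
is 0, so the counts still match and the inductive hypothesis applies. -/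
theorem Regular.alternates_succ (h : Regular Q θ n p k C) (hn : 1 ≤ n) (hk : 1 ≤ k)
    (hkp : k + 1 ≤ p) (a b : ℕ) (ε : ℝ) (c : ℕ → ℝ) (hab : a < b) (ha : p + 1 ≤ a + (k + 1))
    (hb : b ≤ p + n + 1) (hc0 : ∀ i, i < a ∨ b ≤ i → c i = 0)
    (hc : ∀ i, a ≤ i → i < b → 0 < ε * (-1) ^ i * c i) :
    ¬ Alternates (spl Q θ n p (k + 1) c) (b - a) (-(ε * (-1) ^ a)) 0 := by
  set d := dcoef Q θ n p k c with hd
  set f := spl Q θ n p (k + 1) c with hf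
  set g := spl Q θ n p k d with hg
  have hfg : ∀ x y, 0 ≤ x → x ≤ y → y < 1 → f y - f x = ∫ s in x..y, g s :=
    fun x y hx hxy hy => h.spl_succ_sub hn hk (by omega) c hx hxy (Or.inl hy)
  have hg1 : g 1 = 0 := h.spl_eq_zero hn d le_rfl
  have hf1 : f 1 = 0 := Finset.sum_eq_zero fun i _ => by
    rw [h.gbSpline_succ_eq_zero hn hk i zero_le_one (Or.inr (knot_le_one hn _)), mul_zero]
  have hend : b ≤ p + n → ∀ x, 0 ≤ x → x < 1 → - f x = ∫ s in x..1, g s := by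
    intro hb x hx hx1
    rw [← h.spl_succ_sub hn hk (by omega) c hx hx1.le
      (Or.inr fun i hi => hc0 i (Or.inr (by omega)))]
    rw [← hf, hf1, zero_sub]
  have hstart : p + 1 ≤ a + k → f 0 = 0 := by
    intro ha
    refine Finset.sum_eq_zero fun i _ => ?_
    rcases lt_or_ge i a with hi | hi
    · rw [hc0 i (Or.inl hi), zero_mul]
    · have key : ∀ j, a ≤ j → primitive Q θ n p k j 0 = 0 := by
        intro j hj
        by_cases hj' : p + 1 ≤ j + k ∧ j ≤ p + n
        · rw [primitive_of_nondegenerate hn hk hj']; simp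
        · rw [primitive_of_degenerate hn hk hj', if_neg]
          rw [knot_eq_one hn (by omega)]; norm_num
      rw [gbSpline_succ hk, key i hi, key (i + 1) (by omega)]; simp
  have hc_nonneg : ∀ i, 0 ≤ ε * (-1) ^ i * c i := by
    intro i
    by_cases hi : a ≤ i ∧ i < b
    · exact (hc i hi.1 hi.2).le
    · rw [hc0 i (by omega), mul_zero]
  have hd_zero : ∀ i, i < a ∨ b + 1 ≤ i → d i = 0 := by
    intro i hi
    rw [hd, dcoef, hc0 i (by omega), hc0 (i - 1) (by omega)]; simp
  have hd_deg : ∀ i, ¬ (p + 1 ≤ i + k ∧ i ≤ p + n) → d i = 0 := by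
    intro i hi
    rw [hd, dcoef, h.mass_eq_zero hn hk hi, div_zero]
  have hd_pos : ∀ i, a ≤ i → i < b + 1 → p + 1 ≤ i + k → i ≤ p + n → 0 < ε * (-1) ^ i * d i := by
    intro i h1 h2 h3 h4
    obtain ⟨j, rfl⟩ : ∃ j, i = j + 1 := ⟨i - 1, by omega⟩
    have e : ε * (-1) ^ (j + 1) * d (j + 1) =
        (ε * (-1) ^ (j + 1) * c (j + 1) + ε * (-1) ^ j * c j) / mass Q θ n p k (j + 1) := by
      rw [hd, dcoef, Nat.add_sub_cancel, pow_succ]; ring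
    rw [e]
    refine div_pos ?_ (h.mass_pos hn hk h3 h4)
    rcases lt_or_ge (j + 1) b with h5 | h5
    · have := hc (j + 1) h1 h5
      linarith [hc_nonneg j]
    · have := hc j (by omega) (by omega)
      linarith [hc_nonneg (j + 1)]
  -- The window [a', b') is [a, b + 1) with degenerate end indices trimmed; each end may be trimmed
  -- only if its index is degenerate.
  have halt : ∀ a' b', a' < b' → p + 1 ≤ a' + k → b' ≤ p + n + 1 → a ≤ a' → a' ≤ a + 1 → b' ≤ b + 1 →
      (a < a' → a + k < p + 1) → (b' < b + 1 → p + n < b) → (b ≤ b') →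
      ¬ Alternates g (b' - a') (-(ε * (-1) ^ a')) 0 := by
    intro a' b' h1 h2 h3 h4 h4' h5 h6 h7 h8
    refine h.alternates a' b' ε d h1 h2 h3 ?_ ?_
    · intro i hi
      by_cases hz : i < a ∨ b + 1 ≤ i
      · exact hd_zero i hz
      · refine hd_deg i ?_
        rintro ⟨h9, h10⟩
        rcases hi with hi | hi <;> omega
    · intro i h9 h10
      exact hd_pos i (by omega) (by omega) (by omega) (by omega)
  obtain ⟨m, hm⟩ : ∃ m, b - a = m + 1 := ⟨b - a - 1, by omega⟩
  rw [hm]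
  intro hA
  by_cases has : p + 1 ≤ a + k
  · by_cases hbe : b ≤ p + n
    · have := Alternates.rolle_of_start_end hfg (hstart has) (hend hbe) hg1 hA
      refine halt a (b + 1) (by omega) (by omega) (by omega) (by omega) (by omega) (by omega)
        (by omega) (by omega) (by omega) ?_
      rwa [show b + 1 - a = m + 2 by omega]
    · have := Alternates.rolle hfg le_rfl zero_lt_one (by rw [hstart has]; simp) hA
      refine halt a b (by omega) (by omega) (by omega) (by omega) (by omega) (by omega)
        (by omega) (by omega) (by omega) ?_
      rwa [hm]
  -- At the left boundary f(0) is unknown, so the first alternation point serves as the starting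
  -- point for Rolle and the sign flips.
  · obtain ⟨x, hx0, hx1, hx, hA⟩ := hA
    have hσ : -(ε * (-1) ^ (a + 1)) = - -(ε * (-1 : ℝ) ^ a) := by rw [pow_succ]; ring
    by_cases hbe : b ≤ p + n
    · have := (Alternates.rolle_of_end hfg (hend hbe) hg1 hx0 hx1 (by linarith) hA).mono hx0
      refine halt (a + 1) (b + 1) (by omega) (by omega) (by omega) (by omega) (by omega) (by omega)
        (by omega) (by omega) (by omega) ?_
      rwa [show b + 1 - (a + 1) = m + 1 by omega, hσ]
    · have := (Alternates.rolle hfg hx0 hx1 (by linarith) hA).mono hx0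
      refine halt (a + 1) b (by omega) (by omega) (by omega) (by omega) (by omega) (by omega)
        (by omega) (by omega) (by omega) ?_
      rwa [show b - (a + 1) = m by omega, hσ]

/-- The Lipschitz property in degree k is what the inverse inequality needs; the resulting
derivative bound yields both stability and the Lipschitz property in degree k + 1. -/
theorem Regular.abs_dspl_le (h : Regular Q θ n p k C) (hn : 1 ≤ n) (hk : 1 ≤ k) (hkp : k ≤ p)
    {J : ℕ} (hJ1 : p + 1 ≤ J) (hJ2 : J ≤ p + n) {c : ℕ → ℝ} {B : ℝ}
    (hB : ∀ x ∈ Ioo (knot n p J) (knot n p (J + 1)), |spl Q θ n p (k + 1) c x| ≤ B) :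
    ∀ x ∈ Ioo (knot n p J) (knot n p (J + 1)),
      |spl Q θ n p k (dcoef Q θ n p k c) x| ≤ 16 * C * n * B := by
  have h0 : ∀ x ∈ Ioo (knot n p J) (knot n p (J + 1)), 0 ≤ x := fun x hx =>
    (knot_nonneg hn J).trans hx.1.le
  have h1 : ∀ x ∈ Ioo (knot n p J) (knot n p (J + 1)), x < 1 := fun x hx =>
    hx.2.trans_le (knot_le_one hn _)
  exact abs_le_of_integral_of_lipschitz (by positivity) (knot_succ_sub hn hJ1 hJ2) h.one_le hB
    (fun x hx y hy hxy => h.spl_succ_sub hn hk hkp c (h0 x hx) hxy (Or.inl (h1 y hy)))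
    (fun x hx y hy => h.spl_intervalIntegrable hn hk _ (h0 x hx) (h0 y hy))
    (fun x hx => h.abs_spl_le hn hk _ (h0 x hx))
    (fun M hM => h.lipschitz J _ M hJ1 hJ2 hM)

theorem Regular.lipschitz_succ (h : Regular Q θ n p k C) (hn : 1 ≤ n) (hk : 1 ≤ k) (hkp : k ≤ p)
    {J : ℕ} (hJ1 : p + 1 ≤ J) (hJ2 : J ≤ p + n) {c : ℕ → ℝ} {B : ℝ}
    (hB : ∀ x ∈ Ioo (knot n p J) (knot n p (J + 1)), |spl Q θ n p (k + 1) c x| ≤ B)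
    {x y : ℝ} (hx : x ∈ Ioo (knot n p J) (knot n p (J + 1)))
    (hy : y ∈ Ioo (knot n p J) (knot n p (J + 1))) :
    |spl Q θ n p (k + 1) c x - spl Q θ n p (k + 1) c y| ≤ 16 * C * n * B * |x - y| := by
  wlog hxy : x ≤ y generalizing x y
  · rw [abs_sub_comm, abs_sub_comm x]
    exact this hy hx (not_le.1 hxy).le
  rw [abs_sub_comm, abs_sub_comm x, h.spl_succ_sub hn hk hkp c ((knot_nonneg hn J).trans hx.1.le)
    hxy (Or.inl (hy.2.trans_le (knot_le_one hn _)))]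
  rw [← Real.norm_eq_abs]
  refine intervalIntegral.norm_integral_le_of_norm_le_const fun s hs => ?_
  rw [uIoc_of_le hxy] at hs
  exact h.abs_dspl_le hn hk hkp hJ1 hJ2 hB s ⟨hx.1.trans hs.1, hs.2.trans_lt hy.2⟩

/-- Each difference c_i - c_{i-1} is a derivative coefficient, of size O(nB), times a mass of size
O(1/n), so n cancels. By the partition of unity the spline at the midpoint is an average of nearby
coefficients, which fixes their common level. -/
theorem Regular.stable_succ (h : Regular Q θ n p k C) (hn : 1 ≤ n) (hk : 1 ≤ k) (hkp : k ≤ p)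
    (hnonneg : ∀ i x, 0 ≤ x → 0 ≤ gbSpline Q θ (knot n p) (k + 1) i x)
    {J : ℕ} (hJ1 : p + 1 ≤ J) (hJ2 : J ≤ p + n) {c : ℕ → ℝ} {B : ℝ}
    (hB : ∀ x ∈ Ioo (knot n p J) (knot n p (J + 1)), |spl Q θ n p (k + 1) c x| ≤ B)
    {i : ℕ} (hi1 : J ≤ i + (k + 1)) (hi2 : i ≤ J) :
    |c i| ≤ (1 + 32 * C ^ 3 * (k + 1) ^ 2) * B := by
  have hC := h.one_le
  have hn0 : (0 : ℝ) < n := by positivity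
  have hne := knot_lt_succ hn hJ1 hJ2
  set x := (knot n p J + knot n p (J + 1)) / 2 with hx
  have hxI : x ∈ Ioo (knot n p J) (knot n p (J + 1)) := ⟨by linarith, by linarith⟩
  have hx0 : 0 ≤ x := (knot_nonneg hn J).trans hxI.1.le
  have hx1 : x < 1 := hxI.2.trans_le (knot_le_one hn _)
  have hB0 : 0 ≤ B := (abs_nonneg _).trans (hB x hxI)
  set E := 16 * C ^ 3 * (k + 1) * B with hE
  have hE0 : 0 ≤ E := by positivity
  have hstep : ∀ i, J ≤ i + k → i ≤ J → |c i - c (i - 1)| ≤ E := by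
    intro i h1 h2
    have hd := h.stable J _ _ hJ1 hJ2 (h.abs_dspl_le hn hk hkp hJ1 hJ2 hB) i h1 h2
    have hm := h.mass_pos hn hk (i := i) (by omega) (by omega)
    rw [dcoef, abs_div, abs_of_pos hm, div_le_iff₀ hm] at hd
    refine hd.trans ?_
    calc _ ≤ C * (16 * C * n * B) * (C * (k + 1) / n) :=
          mul_le_mul_of_nonneg_left (h.mass_le hn hk i) (by positivity)
      _ = E := by rw [hE]; field_simp
  have hdiff : ∀ m : ℕ, m ≤ k + 1 → |c (J - m) - c J| ≤ m * E := by
    intro m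
    induction m with
    | zero => simp
    | succ m ih =>
      intro hm
      have h1 := ih (by omega)
      have h2 := hstep (J - m) (by omega) (by omega)
      rw [Nat.sub_sub, abs_sub_comm] at h2
      have := abs_add_le (c (J - (m + 1)) - c (J - m)) (c (J - m) - c J)
      rw [sub_add_sub_cancel] at this
      push_cast
      linarith
  have hdiff' : ∀ i, J ≤ i + (k + 1) → i ≤ J → |c i - c J| ≤ (k + 1) * E := by
    intro i h1 h2
    have := hdiff (J - i) (by omega)
    rw [Nat.sub_sub_self h2] at this
    refine this.trans (mul_le_mul_of_nonneg_right ?_ hE0)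
    exact_mod_cast (by omega)
  have hsum := h.sum_gbSpline_succ hn hk hkp hx0 hx1
  have hcJ : |c J| ≤ B + (k + 1) * E := by
    have e : c J = spl Q θ n p (k + 1) c x - ∑ i ∈ Finset.range (p + n + 1),
        (c i - c J) * gbSpline Q θ (knot n p) (k + 1) i x := by
      rw [spl, ← Finset.sum_sub_distrib]
      simp_rw [← sub_mul, sub_sub_cancel]
      rw [← Finset.mul_sum, hsum, mul_one]
    have h2 : |∑ i ∈ Finset.range (p + n + 1),
        (c i - c J) * gbSpline Q θ (knot n p) (k + 1) i x| ≤ (k + 1) * E := by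
      calc _ ≤ ∑ i ∈ Finset.range (p + n + 1),
            ((k + 1) * E) * gbSpline Q θ (knot n p) (k + 1) i x := by
            refine (Finset.abs_sum_le_sum_abs _ _).trans (Finset.sum_le_sum fun i _ => ?_)
            rw [abs_mul, abs_of_nonneg (hnonneg i x hx0)]
            by_cases hz : x < knot n p i ∨ knot n p (i + (k + 1) + 1) ≤ x
            · rw [h.gbSpline_succ_eq_zero hn hk i hx0 hz]; simp
            · refine mul_le_mul_of_nonneg_right (hdiff' i ?_ ?_) (hnonneg i x hx0)
              · by_contra h3
                exact hz (Or.inr ((knot_mono hn (by omega)).trans hxI.1.le))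
              · by_contra h3
                exact hz (Or.inl (hxI.2.trans_le (knot_mono hn (by omega))))
        _ = _ := by rw [← Finset.mul_sum, hsum, mul_one]
    rw [e]
    refine (abs_sub _ _).trans (add_le_add (hB x hxI) h2)
  have h1 := hdiff' i hi1 hi2
  have h2 := abs_add_le (c i - c J) (c J)
  rw [sub_add_cancel] at h2
  calc |c i| ≤ B + 2 * ((k + 1) * E) := by linarith
    _ = _ := by rw [hE]; ring

theorem Regular.succ (h : Regular Q θ n p k C) (hn : 1 ≤ n) (hk : 1 ≤ k) (hkp : k + 1 ≤ p) :
    Regular Q θ n p (k + 1) (16 * C + 32 * C ^ 3 * (k + 1) ^ 2) := by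
  have hC := h.one_le
  have hC3 : 0 ≤ 32 * C ^ 3 * ((k : ℝ) + 1) ^ 2 := by positivity
  have hB0 : ∀ {c : ℕ → ℝ} {J : ℕ} {B : ℝ}, p + 1 ≤ J → J ≤ p + n →
      (∀ x ∈ Ioo (knot n p J) (knot n p (J + 1)), |spl Q θ n p (k + 1) c x| ≤ B) → 0 ≤ B := by
    intro c J B h1 h2 hB
    have := knot_lt_succ hn h1 h2
    exact (abs_nonneg _).trans
      (hB ((knot n p J + knot n p (J + 1)) / 2) ⟨by linarith, by linarith⟩)
  have halt := h.alternates_succ hn hk hkp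
  refine ⟨by linarith, h.measurable_succ hn hk,
    fun i x hx hxi => h.gbSpline_succ_eq_zero hn hk i hx hxi,
    fun x hx => (h.sum_gbSpline_succ_le hn hk (by omega) hx).trans (by linarith), ?_, ?_, halt⟩
  · intro J c B hJ1 hJ2 hB i hi1 hi2
    refine (h.stable_succ hn hk (by omega) (fun i x hx => ?_) hJ1 hJ2 hB hi1 hi2).trans
      (mul_le_mul_of_nonneg_right (by linarith) (hB0 hJ1 hJ2 hB))
    exact gbSpline_nonneg (fun i x hx hxi => h.gbSpline_succ_eq_zero hn hk i hx hxi) halt hn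
      (by omega) i hx
  · intro J c B hJ1 hJ2 hB x hx y hy
    refine (h.lipschitz_succ hn hk (by omega) hJ1 hJ2 hB hx hy).trans ?_
    have := hB0 hJ1 hJ2 hB
    gcongr
    linarith

end Succ

/-! ### The generators of the section spaces -/

/-- The function `u ↦ Q.odd (δ u) / Q.odd δ` is nonnegative with Lipschitz constant `K` on
`[0, 1]`. -/
structure OddBound (Q : Kind) (δ K : ℝ) : Prop where
  one_le : 1 ≤ K
  pos : 0 < Q.odd δ
  nonneg : ∀ u ∈ Icc (0 : ℝ) 1, 0 ≤ Q.odd (δ * u)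
  lipschitz : ∀ u ∈ Icc (0 : ℝ) 1, ∀ v ∈ Icc (0 : ℝ) 1,
    |Q.odd (δ * u) - Q.odd (δ * v)| ≤ K * Q.odd δ * |u - v|

theorem Kind.odd_zero (Q : Kind) : Q.odd 0 = 0 := by cases Q <;> simp [Kind.odd]

theorem Kind.continuous_odd (Q : Kind) : Continuous Q.odd := by
  cases Q
  · exact Real.continuous_sinh
  · exact Real.continuous_sin

/-- Common consequence of the addition formulas for sinh and sin; it makes the ratio of rising to
falling functions monotone. -/
theorem Kind.odd_identity (Q : Kind) (a b d : ℝ) :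
    Q.odd a * Q.odd (d - b) - Q.odd b * Q.odd (d - a) = Q.odd d * Q.odd (a - b) := by
  cases Q
  · simp only [Kind.odd, Real.sinh_sub]; ring
  · simp only [Kind.odd, Real.sin_sub]; ring

theorem oddBound_hyperbolic {δ α : ℝ} (hδ : 0 < δ) (hα : δ ≤ α) :
    OddBound .hyperbolic δ (Real.cosh α) where
  one_le := Real.one_le_cosh α
  pos := Real.sinh_pos_iff.2 hδ
  nonneg := fun u hu => Real.sinh_nonneg_iff.2 (mul_nonneg hδ.le hu.1)
  lipschitz := by
    intro u hu v hv
    have h := (convex_Icc (0 : ℝ) α).norm_image_sub_le_of_norm_deriv_le (f := Real.sinh)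
      (C := Real.cosh α) (x := δ * v) (y := δ * u) (fun x _ => Real.differentiableAt_sinh)
      (fun x hx => by
        rw [Real.deriv_sinh, Real.norm_eq_abs, abs_of_pos (Real.cosh_pos x), Real.cosh_le_cosh,
          abs_of_nonneg hx.1, abs_of_nonneg (hδ.le.trans hα)]
        exact hx.2)
      ⟨mul_nonneg hδ.le hv.1, by nlinarith [hv.2]⟩ ⟨mul_nonneg hδ.le hu.1, by nlinarith [hu.2]⟩
    rw [Real.norm_eq_abs, Real.norm_eq_abs, ← mul_sub, abs_mul, abs_of_pos hδ] at h
    refine h.trans ?_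
    rw [← mul_assoc]
    refine mul_le_mul_of_nonneg_right (mul_le_mul_of_nonneg_left ?_ (Real.cosh_pos α).le)
      (abs_nonneg _)
    exact Real.self_le_sinh_iff.2 hδ.le

theorem oddBound_trigonometric {δ δ₀ : ℝ} (hδ : 0 < δ) (h0 : δ ≤ δ₀) (hpi : δ₀ < Real.pi) :
    OddBound .trigonometric δ (δ₀ / Real.sin δ₀) := by
  have hδ₀ : 0 < δ₀ := hδ.trans_le h0
  have hs0 : 0 < Real.sin δ₀ := Real.sin_pos_of_pos_of_lt_pi hδ₀ hpi
  have hs : 0 < Real.sin δ := Real.sin_pos_of_pos_of_lt_pi hδ (h0.trans_lt hpi)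
  -- By concavity on [0, π], sin δ / δ is at least sin δ₀ / δ₀.
  have hK : δ ≤ δ₀ / Real.sin δ₀ * Real.sin δ := by
    have h := strictConcaveOn_sin_Icc.concaveOn.2 (show δ₀ ∈ Icc 0 Real.pi from ⟨hδ₀.le, hpi.le⟩)
      (show (0 : ℝ) ∈ Icc 0 Real.pi from ⟨le_rfl, Real.pi_pos.le⟩)
      (show 0 ≤ δ / δ₀ by positivity)
      (show 0 ≤ 1 - δ / δ₀ by rw [sub_nonneg]; exact div_le_one_of_le₀ h0 hδ₀.le) (by ring)
    simp only [smul_eq_mul, mul_zero, Real.sin_zero, add_zero, div_mul_cancel₀ _ hδ₀.ne'] at h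
    rw [div_mul_eq_mul_div, le_div_iff₀ hs0]
    rw [div_mul_eq_mul_div, div_le_iff₀ hδ₀] at h
    linarith
  refine ⟨?_, hs, ?_, ?_⟩
  · rw [le_div_iff₀ hs0, one_mul]
    exact Real.sin_le hδ₀.le
  · intro u hu
    refine Real.sin_nonneg_of_nonneg_of_le_pi (mul_nonneg hδ.le hu.1) ?_
    nlinarith [hu.2]
  · intro u hu v hv
    have h : |Real.sin (δ * u) - Real.sin (δ * v)| ≤ |δ * u - δ * v| := by
      have := Real.lipschitzWith_sin.dist_le_mul (δ * u) (δ * v)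
      simpa [Real.dist_eq] using this
    refine h.trans ?_
    rw [← mul_sub, abs_mul, abs_of_pos hδ]
    exact mul_le_mul_of_nonneg_right hK (abs_nonneg _)

/-- Always δ = θ/n ≤ α, which suffices for sinh. For sin, δ must also stay away from π uniformly in
n: in the non-nested case δ is constant, and in the nested case the largest admissible δ occurs at n
= ⌊α/π⌋ + 1. -/
theorem exists_oddBound (Q : Kind) (μ : Mode) {α : ℝ} (hα : 0 < α) :
    ∃ K : ℝ, 1 ≤ K ∧ ∀ n : ℕ, 1 ≤ n → Admissible Q (μ.param α n) n →
      OddBound Q (μ.param α n / n) K := by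
  have hle : ∀ n : ℕ, 1 ≤ n → 0 < μ.param α n / n ∧ μ.param α n / n ≤ α := by
    intro n hn
    have hn0 : (1 : ℝ) ≤ n := by exact_mod_cast hn
    cases μ
    · exact ⟨div_pos hα (by linarith), div_le_self hα.le hn0⟩
    · simp only [Mode.param]
      rw [mul_div_cancel_left₀ _ (by linarith)]
      exact ⟨hα, le_rfl⟩
  cases Q with
  | hyperbolic =>
    exact ⟨Real.cosh α, Real.one_le_cosh α, fun n hn _ =>
      oddBound_hyperbolic (hle n hn).1 (hle n hn).2⟩
  | trigonometric =>
    obtain ⟨δ₀, h1, h2⟩ : ∃ δ₀ < Real.pi, ∀ n : ℕ, 1 ≤ n →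
        Admissible .trigonometric (μ.param α n) n → μ.param α n / n ≤ δ₀ := by
      cases μ with
      | nested =>
        refine ⟨α / (⌊α / Real.pi⌋₊ + 1), ?_, fun n hn h => ?_⟩
        · rw [div_lt_comm₀ (by positivity) Real.pi_pos]
          exact Nat.lt_floor_add_one _
        · have hn0 : (0 : ℝ) < n := by exact_mod_cast hn
          have h3 : α / n < Real.pi := h
          rw [div_lt_comm₀ hn0 Real.pi_pos, ← Nat.floor_lt (by positivity)] at h3
          refine div_le_div_of_nonneg_left hα.le (by positivity) ?_
          exact_mod_cast h3
      | nonNested =>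
        by_cases h : α < Real.pi
        · exact ⟨α, h, fun n hn _ => (hle n hn).2⟩
        -- No n is admissible here, so the value 0 is arbitrary.
        · refine ⟨0, Real.pi_pos, fun n hn h' => absurd ?_ h⟩
          have hn0 : (n : ℝ) ≠ 0 := by positivity
          have h3 : n * α / n < Real.pi := h'
          rwa [mul_div_cancel_left₀ _ hn0] at h3
    by_cases hex : ∃ n : ℕ, 1 ≤ n ∧ Admissible .trigonometric (μ.param α n) n
    · obtain ⟨m, hm, hma⟩ := hex
      exact ⟨_, (oddBound_trigonometric (hle m hm).1 (h2 m hm hma) h1).one_le, fun n hn h =>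
        oddBound_trigonometric (hle n hn).1 (h2 n hn h) h1⟩
    · exact ⟨1, le_rfl, fun n hn h => absurd ⟨n, hn, h⟩ hex⟩

section Cell

variable {Q : Kind} {θ K a b : ℝ} {n : ℕ}

theorem falling_eq_rising (x : ℝ) : falling Q θ a b x = rising Q θ a b (a + b - x) := by
  rw [falling, rising, show a + b - x - a = b - x by ring]

theorem rising_eq (hn : 1 ≤ n) (hab : b - a = 1 / n) (x : ℝ) :
    rising Q θ a b x = Q.odd (θ / n * (n * (x - a))) / Q.odd (θ / n) := by
  have hn0 : (n : ℝ) ≠ 0 := by positivity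
  rw [rising, hab]
  congr 2
  · field_simp
  · ring

theorem mul_sub_mem_Icc (hn : 1 ≤ n) (hab : b - a = 1 / n) {x : ℝ} (hx : x ∈ Icc a b) :
    n * (x - a) ∈ Icc (0 : ℝ) 1 := by
  have hn0 : (0 : ℝ) < n := by positivity
  refine ⟨mul_nonneg hn0.le (sub_nonneg.2 hx.1), ?_⟩
  have : n * (x - a) ≤ n * (b - a) := mul_le_mul_of_nonneg_left (by linarith [hx.2]) hn0.le
  rwa [hab, mul_one_div_cancel hn0.ne'] at this

variable (h : OddBound Q (θ / n) K) (hn : 1 ≤ n) (hab : b - a = 1 / n)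
include h hn hab

theorem rising_nonneg {x : ℝ} (hx : x ∈ Icc a b) : 0 ≤ rising Q θ a b x := by
  rw [rising_eq hn hab]
  exact div_nonneg (h.nonneg _ (mul_sub_mem_Icc hn hab hx)) h.pos.le

theorem rising_lipschitz {x y : ℝ} (hx : x ∈ Icc a b) (hy : y ∈ Icc a b) :
    |rising Q θ a b x - rising Q θ a b y| ≤ K * n * |x - y| := by
  rw [rising_eq hn hab, rising_eq hn hab, ← sub_div, abs_div, abs_of_pos h.pos,
    div_le_iff₀ h.pos]
  refine (h.lipschitz _ (mul_sub_mem_Icc hn hab hx) _ (mul_sub_mem_Icc hn hab hy)).trans ?_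
  rw [← mul_sub, abs_mul, abs_of_nonneg (Nat.cast_nonneg n), sub_sub_sub_cancel_right]
  exact le_of_eq (by ring)

omit hn in
theorem rising_right : rising Q θ a b b = 1 := by
  have := h.pos
  rw [rising, div_self]
  rw [hab, mul_one_div]
  exact this.ne'

omit h hn hab in
theorem rising_left : rising Q θ a b a = 0 := by
  rw [rising, sub_self, mul_zero, Q.odd_zero, zero_div]

theorem rising_le {x : ℝ} (hx : x ∈ Icc a b) : rising Q θ a b x ≤ K := by
  have h1 := rising_lipschitz h hn hab hx (y := a) ⟨le_rfl, hx.1.trans hx.2⟩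
  rw [rising_left, sub_zero, abs_of_nonneg (sub_nonneg.2 hx.1)] at h1
  have h2 := (mul_sub_mem_Icc hn hab hx).2
  have := le_abs_self (rising Q θ a b x)
  nlinarith [h.one_le]

theorem falling_nonneg {x : ℝ} (hx : x ∈ Icc a b) : 0 ≤ falling Q θ a b x := by
  rw [falling_eq_rising]
  exact rising_nonneg h hn hab ⟨by linarith [hx.2], by linarith [hx.1]⟩

theorem falling_le {x : ℝ} (hx : x ∈ Icc a b) : falling Q θ a b x ≤ K := by
  rw [falling_eq_rising]
  exact rising_le h hn hab ⟨by linarith [hx.2], by linarith [hx.1]⟩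

theorem falling_lipschitz {x y : ℝ} (hx : x ∈ Icc a b) (hy : y ∈ Icc a b) :
    |falling Q θ a b x - falling Q θ a b y| ≤ K * n * |x - y| := by
  rw [falling_eq_rising, falling_eq_rising]
  refine (rising_lipschitz h hn hab ⟨by linarith [hx.2], by linarith [hx.1]⟩
    ⟨by linarith [hy.2], by linarith [hy.1]⟩).trans (le_of_eq ?_)
  rw [abs_sub_comm x, sub_sub_sub_cancel_left]

/-- The quotient of the rising and the falling function is monotone. -/
theorem rising_mul_falling_le {x y : ℝ} (hx : x ∈ Icc a b) (hy : y ∈ Icc a b) (hxy : x ≤ y) :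
    rising Q θ a b x * falling Q θ a b y ≤ rising Q θ a b y * falling Q θ a b x := by
  have hpos : 0 < Q.odd (θ * (b - a)) := by
    rw [hab, mul_one_div]; exact h.pos
  have h1 := Q.odd_identity (θ * (y - a)) (θ * (x - a)) (θ * (b - a))
  have h2 : 0 ≤ Q.odd (θ * (y - a) - θ * (x - a)) := by
    have := h.nonneg _ (mul_sub_mem_Icc hn hab (x := a + (y - x))
      ⟨by linarith, by linarith [hx.1, hy.2]⟩)
    have hn0 : (n : ℝ) ≠ 0 := by positivity
    convert this using 2
    field_simp
    ring
  have h3 := mul_nonneg hpos.le h2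
  rw [← h1, ← mul_sub, ← mul_sub, sub_sub_sub_cancel_right, sub_sub_sub_cancel_right] at h3
  rw [rising, rising, falling, falling, div_mul_div_comm, div_mul_div_comm]
  exact div_le_div_of_nonneg_right (by linarith) (mul_pos hpos hpos).le

end Cell

/-! ### Degree one -/

section Base

variable {Q : Kind} {θ K : ℝ} {n p : ℕ}

theorem gbSpline_one (i : ℕ) (x : ℝ) : gbSpline Q θ (knot n p) 1 i x =
    if x ∈ Ico (knot n p i) (knot n p (i + 1)) then
      rising Q θ (knot n p i) (knot n p (i + 1)) x
    else if x ∈ Ico (knot n p (i + 1)) (knot n p (i + 2)) then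
      falling Q θ (knot n p (i + 1)) (knot n p (i + 2)) x
    else 0 := rfl

theorem gbSpline_one_eq_zero (hn : 1 ≤ n) (i : ℕ) {x : ℝ}
    (hx : x < knot n p i ∨ knot n p (i + 2) ≤ x) : gbSpline Q θ (knot n p) 1 i x = 0 := by
  have h1 : knot n p i ≤ knot n p (i + 1) := knot_mono hn (by omega)
  have h2 : knot n p (i + 1) ≤ knot n p (i + 2) := knot_mono hn (by omega)
  rw [gbSpline_one, if_neg, if_neg]
  · rintro ⟨h3, h4⟩; rcases hx with hx | hx <;> linarith
  · rintro ⟨h3, h4⟩; rcases hx with hx | hx <;> linarith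

theorem spl_one_eq (hn : 1 ≤ n) (hp : 1 ≤ p) (c : ℕ → ℝ) {J : ℕ} (hJ1 : p + 1 ≤ J) (hJ2 : J ≤ p + n)
    {x : ℝ} (hx : x ∈ Ico (knot n p J) (knot n p (J + 1))) :
    spl Q θ n p 1 c x = c (J - 1) * falling Q θ (knot n p J) (knot n p (J + 1)) x
      + c J * rising Q θ (knot n p J) (knot n p (J + 1)) x := by
  obtain ⟨j, rfl⟩ : ∃ j, J = j + 1 := ⟨J - 1, by omega⟩
  have hj : gbSpline Q θ (knot n p) 1 j x =
      falling Q θ (knot n p (j + 1)) (knot n p (j + 1 + 1)) x := by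
    rw [gbSpline_one, if_neg (fun h => (not_lt.2 hx.1) h.2), if_pos hx]
  have hj' : gbSpline Q θ (knot n p) 1 (j + 1) x =
      rising Q θ (knot n p (j + 1)) (knot n p (j + 1 + 1)) x := by
    rw [gbSpline_one, if_pos hx]
  rw [spl, Nat.add_sub_cancel, ← hj, ← hj']
  have hsub : ({j, j + 1} : Finset ℕ) ⊆ Finset.range (p + n + 1) := by
    intro i hi
    simp only [Finset.mem_insert, Finset.mem_singleton] at hi
    rw [Finset.mem_range]; omega
  rw [← Finset.sum_subset hsub, Finset.sum_pair (by omega)]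
  intro i _ hi
  simp only [Finset.mem_insert, Finset.mem_singleton, not_or] at hi
  rw [gbSpline_one_eq_zero hn, mul_zero]
  rcases lt_or_ge i j with h | h
  · right
    exact (knot_mono hn (by omega)).trans hx.1
  · left
    exact hx.2.trans_le (knot_mono hn (by omega))

theorem continuous_rising (a b : ℝ) : Continuous (rising Q θ a b) := by
  have hodd := Q.continuous_odd
  unfold rising; fun_prop

theorem continuous_falling (a b : ℝ) : Continuous (falling Q θ a b) := by
  have hodd := Q.continuous_odd
  unfold falling; fun_prop

theorem measurable_gbSpline_one (i : ℕ) : Measurable (gbSpline Q θ (knot n p) 1 i) := by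
  rw [show gbSpline Q θ (knot n p) 1 i = _ from funext fun x => gbSpline_one i x]
  exact Measurable.ite measurableSet_Ico (continuous_rising _ _).measurable
    (Measurable.ite measurableSet_Ico (continuous_falling _ _).measurable measurable_const)

/-- Variation diminution in degree one: the alternations of a spline are found in its
coefficients. -/
theorem exists_coeff_of_alternates (h : OddBound Q (θ / n) K) (hn : 1 ≤ n) (hp : 1 ≤ p)
    {c : ℕ → ℝ} {b : ℕ} (hc : ∀ i, b ≤ i → c i = 0) {r : ℕ} :
    ∀ {σ x : ℝ} {J : ℕ}, p + 1 ≤ J → J ≤ p + n → x ∈ Ico (knot n p J) (knot n p (J + 1)) →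
      0 < σ * spl Q θ n p 1 c x → Alternates (spl Q θ n p 1 c) r (-σ) x →
      ∃ i, J - 1 ≤ i ∧ 0 < σ * c i ∧ i + r + 1 ≤ b := by
  have hb : ∀ {σ : ℝ} {i : ℕ}, 0 < σ * c i → i < b := by
    intro σ i hi
    by_contra hib
    rw [hc i (not_lt.1 hib), mul_zero] at hi
    exact lt_irrefl _ hi
  have hpos : ∀ {σ x : ℝ} {J : ℕ}, p + 1 ≤ J → J ≤ p + n →
      x ∈ Ico (knot n p J) (knot n p (J + 1)) → 0 < σ * spl Q θ n p 1 c x →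
      0 < σ * c (J - 1) ∨ (σ * c (J - 1) ≤ 0 ∧ 0 < σ * c J) := by
    intro σ x J hJ1 hJ2 hx hσ
    have hab := knot_succ_sub hn hJ1 hJ2
    have hx' := Ico_subset_Icc_self hx
    have hF := falling_nonneg h hn hab hx'
    have hR := rising_nonneg h hn hab hx'
    rw [spl_one_eq hn hp c hJ1 hJ2 hx] at hσ
    by_contra hcon
    push Not at hcon
    have h2 := hcon.2 hcon.1
    nlinarith [mul_nonneg hF (neg_nonneg.2 hcon.1), mul_nonneg hR (neg_nonneg.2 h2)]
  induction r with
  | zero =>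
    intro σ x J hJ1 hJ2 hx hσ _
    rcases hpos hJ1 hJ2 hx hσ with h1 | ⟨_, h1⟩
    · exact ⟨J - 1, le_rfl, h1, hb h1⟩
    · exact ⟨J, by omega, h1, hb h1⟩
  | succ r ih =>
    rintro σ x J hJ1 hJ2 hx hσ ⟨y, hxy, hy1, hy, hA⟩
    obtain ⟨J', hJ1', hJ2', hyJ'⟩ :=
      exists_knot_interval (n := n) (p := p) hn (((knot_nonneg hn J).trans hx.1).trans hxy) hy1
    have hJJ' : J ≤ J' := by
      by_contra hcon
      have : knot n p (J' + 1) ≤ knot n p J := knot_mono hn (by omega)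
      linarith [hyJ'.2, hx.1]
    obtain ⟨i', hi1, hi2, hi3⟩ := ih hJ1' hJ2' hyJ' hy hA
    have hne : ∀ i, 0 < σ * c i → i ≠ i' := by
      rintro i hi rfl
      linarith
    -- The leftmost coefficient of the right sign is chosen, so that the index i' from the later
    -- point lies strictly beyond it.
    rcases hpos hJ1 hJ2 hx hσ with h1 | ⟨h0, h1⟩
    · have := hne _ h1
      exact ⟨J - 1, le_rfl, h1, by omega⟩
    · rcases lt_or_eq_of_le hJJ' with hlt | rfl
      · have := hne _ h1
        exact ⟨J, by omega, h1, by omega⟩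
      -- Both points share a knot interval whose left coefficient has sign -σ or is 0 and whose
      -- right one has sign σ. As rising/falling increases, σ times the spline cannot pass from
      -- positive to negative there.
      · exfalso
        have hab := knot_succ_sub hn hJ1 hJ2
        have hx' := Ico_subset_Icc_self hx
        have hy' := Ico_subset_Icc_self (show y ∈ Ico _ _ from hyJ')
        have hFx := falling_nonneg h hn hab hx'
        have hRx := rising_nonneg h hn hab hx'
        have hFy := falling_nonneg h hn hab hy'
        have hRy := rising_nonneg h hn hab hy'
        have hmon := rising_mul_falling_le h hn hab hx' hy' hxy
        rw [spl_one_eq hn hp c hJ1 hJ2 hx] at hσ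
        rw [spl_one_eq hn hp c hJ1 hJ2 hyJ'] at hy
        set Fx := falling Q θ (knot n p J) (knot n p (J + 1)) x
        set Fy := falling Q θ (knot n p J) (knot n p (J + 1)) y
        set Rx := rising Q θ (knot n p J) (knot n p (J + 1)) x
        set Ry := rising Q θ (knot n p J) (knot n p (J + 1)) y
        have e1 : 0 < σ * c (J - 1) * Fx + σ * c J * Rx := by linarith
        have e2 : σ * c (J - 1) * Fy + σ * c J * Ry < 0 := by linarith
        have hFy0 : 0 < Fy := by
          by_contra hcon
          have : Fy = 0 := le_antisymm (not_lt.1 hcon) hFy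
          rw [this] at e2
          nlinarith [mul_nonneg h1.le hRy]
        have e3 := mul_pos e1 hFy0
        have e4 : (σ * c (J - 1) * Fy + σ * c J * Ry) * Fx ≤ 0 :=
          mul_nonpos_of_nonpos_of_nonneg e2.le hFx
        have e5 := mul_le_mul_of_nonneg_left hmon h1.le
        nlinarith

/-- By continuity the bound extends to the closed knot interval, and at its ends the local
expression equals the two coefficients. -/
theorem abs_coeff_le_of_abs_spl_one_le (h : OddBound Q (θ / n) K) (hn : 1 ≤ n) (hp : 1 ≤ p) {J : ℕ}
    (hJ1 : p + 1 ≤ J) (hJ2 : J ≤ p + n) {c : ℕ → ℝ} {B : ℝ}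
    (hB : ∀ x ∈ Ioo (knot n p J) (knot n p (J + 1)), |spl Q θ n p 1 c x| ≤ B) :
    |c (J - 1)| ≤ B ∧ |c J| ≤ B := by
  have hab := knot_succ_sub hn hJ1 hJ2
  have hlt := knot_lt_succ hn hJ1 hJ2
  have hcont : Continuous fun x => c (J - 1) * falling Q θ (knot n p J) (knot n p (J + 1)) x
      + c J * rising Q θ (knot n p J) (knot n p (J + 1)) x :=
    ((continuous_falling _ _).const_mul _).add ((continuous_rising _ _).const_mul _)
  have hcl : closure (Ioo (knot n p J) (knot n p (J + 1))) ⊆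
      {x | |c (J - 1) * falling Q θ (knot n p J) (knot n p (J + 1)) x
        + c J * rising Q θ (knot n p J) (knot n p (J + 1)) x| ≤ B} := by
    refine (isClosed_le hcont.abs continuous_const).closure_subset_iff.2 fun x hx => ?_
    rw [mem_ofPred_eq, ← spl_one_eq hn hp c hJ1 hJ2 (Ioo_subset_Ico_self hx)]
    exact hB x hx
  rw [closure_Ioo hlt.ne] at hcl
  have h1 := hcl (left_mem_Icc.2 hlt.le)
  have h2 := hcl (right_mem_Icc.2 hlt.le)
  simp only [mem_ofPred_eq, falling_eq_rising, add_sub_cancel_left, add_sub_cancel_right,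
    rising_left, rising_right h hab, mul_one, mul_zero, add_zero, zero_add] at h1 h2
  exact ⟨h1, h2⟩

theorem regular_one (h : OddBound Q (θ / n) K) (hn : 1 ≤ n) (hp : 1 ≤ p) :
    Regular Q θ n p 1 (2 * K) where
  one_le := by linarith [h.one_le]
  measurable := measurable_gbSpline_one
  eq_zero := fun i x _ hx => gbSpline_one_eq_zero hn i hx
  sum_le := by
    intro x hx
    rcases lt_or_ge x 1 with hx1 | hx1
    · obtain ⟨J, hJ1, hJ2, hxJ⟩ := exists_knot_interval (n := n) (p := p) hn hx hx1
      have hab := knot_succ_sub hn hJ1 hJ2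
      have hx' := Ico_subset_Icc_self (show x ∈ Ico _ _ from hxJ)
      have e := spl_one_eq (Q := Q) (θ := θ) hn hp (fun _ => 1) hJ1 hJ2 hxJ
      simp only [spl, one_mul] at e
      rw [e]
      linarith [falling_le h hn hab hx', rising_le h hn hab hx']
    · rw [Finset.sum_eq_zero fun i _ =>
        gbSpline_one_eq_zero hn i (Or.inr ((knot_le_one hn _).trans hx1))]
      linarith [h.one_le]
  stable := by
    intro J c B hJ1 hJ2 hB i hi1 hi2
    have hc := abs_coeff_le_of_abs_spl_one_le h hn hp hJ1 hJ2 hB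
    have hB0 := (abs_nonneg _).trans hc.1
    have hi : |c i| ≤ B := by
      obtain rfl | rfl : i = J - 1 ∨ i = J := by omega
      · exact hc.1
      · exact hc.2
    nlinarith [h.one_le]
  lipschitz := by
    intro J c B hJ1 hJ2 hB x hx y hy
    have hc := abs_coeff_le_of_abs_spl_one_le h hn hp hJ1 hJ2 hB
    have hB0 := (abs_nonneg _).trans hc.1
    have hab := knot_succ_sub hn hJ1 hJ2
    rw [spl_one_eq hn hp c hJ1 hJ2 (Ioo_subset_Ico_self hx),
      spl_one_eq hn hp c hJ1 hJ2 (Ioo_subset_Ico_self hy), add_sub_add_comm, ← mul_sub, ← mul_sub]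
    refine (abs_add_le _ _).trans ?_
    rw [abs_mul, abs_mul]
    have hx' := Ioo_subset_Icc_self hx
    have hy' := Ioo_subset_Icc_self hy
    calc _ ≤ B * (K * n * |x - y|) + B * (K * n * |x - y|) :=
          add_le_add
            (mul_le_mul hc.1 (falling_lipschitz h hn hab hx' hy') (abs_nonneg _) hB0)
            (mul_le_mul hc.2 (rising_lipschitz h hn hab hx' hy') (abs_nonneg _) hB0)
      _ = _ := by ring
  alternates := by
    intro a b ε c hab ha hb hc0 hc hA
    obtain ⟨m, hm⟩ : ∃ m, b - a = m + 1 := ⟨b - a - 1, by omega⟩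
    rw [hm] at hA
    obtain ⟨x, hx0, hx1, hx, hA⟩ := hA
    obtain ⟨J, hJ1, hJ2, hxJ⟩ := exists_knot_interval (n := n) (p := p) hn hx0 hx1
    obtain ⟨i, _, hi2, hi3⟩ := exists_coeff_of_alternates h hn hp
      (fun i hi => hc0 i (Or.inr hi)) hJ1 hJ2 hxJ hx hA
    have hia : a ≤ i := by
      by_contra hcon
      rw [hc0 i (Or.inl (by omega)), mul_zero] at hi2
      exact lt_irrefl _ hi2
    obtain rfl : i = a := by omega
    have := hc i le_rfl (by omega)
    linarith

end Base

/-! ### The Galerkin matrix -/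

theorem exists_regular (p : ℕ) {K : ℝ} (hK : 1 ≤ K) {k : ℕ} (hk : 1 ≤ k) (hkp : k ≤ p) :
    ∃ C : ℝ, 1 ≤ C ∧ ∀ (Q : Kind) (θ : ℝ) (n : ℕ), 1 ≤ n → OddBound Q (θ / n) K →
      Regular Q θ n p k C := by
  induction k, hk using Nat.le_induction with
  | base =>
    exact ⟨2 * K, by linarith, fun Q θ n hn h => regular_one h hn hkp⟩
  | succ k hk ih =>
    obtain ⟨C, hC, h⟩ := ih (by omega)
    refine ⟨16 * C + 32 * C ^ 3 * (k + 1) ^ 2, ?_, fun Q θ n hn h' =>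
      (h Q θ n hn h').succ hn hk hkp⟩
    have : 0 ≤ 32 * C ^ 3 * ((k : ℝ) + 1) ^ 2 := by positivity
    linarith

section Matrix

variable {Q : Kind} {θ : ℝ} {n p k : ℕ} {C : ℝ}

theorem sum_mul_spl {ι : Type*} [Fintype ι] (x : ι → ℝ) (d : ι → ℕ → ℝ) (s : ℝ) :
    ∑ j, x j * spl Q θ n p k (d j) s = spl Q θ n p k (fun i => ∑ j, x j * d j i) s := by
  simp only [spl, Finset.mul_sum, Finset.sum_mul]
  rw [Finset.sum_comm]
  refine Finset.sum_congr rfl fun i _ => Finset.sum_congr rfl fun j _ => by ring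

theorem sum_mul_dcoef {ι : Type*} [Fintype ι] (x : ι → ℝ) (c : ι → ℕ → ℝ) (i : ℕ) :
    ∑ j, x j * dcoef Q θ n p k (c j) i = dcoef Q θ n p k (fun i => ∑ j, x j * c j i) i := by
  simp only [dcoef, ← Finset.sum_sub_distrib, Finset.sum_div]
  refine Finset.sum_congr rfl fun j _ => by ring

theorem Regular.continuousAt_spl (h : Regular Q θ n p k C) (hn : 1 ≤ n) (hk : 1 ≤ k) (d : ℕ → ℝ)
    {x : ℝ} (hx : x ∈ Ioo (0 : ℝ) 1 \ range (knot n p)) :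
    ContinuousAt (spl Q θ n p k d) x := by
  obtain ⟨J, hJ1, hJ2, hx1, hx2⟩ := exists_knot_interval (n := n) (p := p) hn hx.1.1.le hx.1.2
  have hxI : x ∈ Ioo (knot n p J) (knot n p (J + 1)) :=
    ⟨lt_of_le_of_ne hx1 fun h => hx.2 ⟨J, h⟩, hx2⟩
  obtain ⟨r, hr, hball⟩ := Metric.isOpen_iff.1 isOpen_Ioo x hxI
  refine continuousAt_of_locally_lipschitz hr
    (C * n * ∑ i ∈ Finset.range (p + n + 1), |d i| * C) fun y hy => ?_
  exact h.lipschitz J d _ hJ1 hJ2 (fun z hz =>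
    h.abs_spl_le hn hk d ((knot_nonneg hn J).trans hz.1.le)) y (hball hy) x hxI

theorem spl_succ_zero (hn : 1 ≤ n) (hk : 1 ≤ k)
    {c : ℕ → ℝ} (h0 : ∀ i, i + k < p + 1 → c i = 0) (h1 : ∀ i, p + n ≤ i → c i = 0) :
    spl Q θ n p (k + 1) c 0 = 0 := by
  refine Finset.sum_eq_zero fun i _ => ?_
  by_cases hc : c i = 0
  · rw [hc, zero_mul]
  · have h2 : p + 1 ≤ i + k := by
      by_contra h; exact hc (h0 i (by omega))
    have h3 : i < p + n := by
      by_contra h; exact hc (h1 i (by omega))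
    rw [gbSpline_succ hk, primitive_of_nondegenerate hn hk ⟨h2, by omega⟩,
      primitive_of_nondegenerate hn hk ⟨by omega, by omega⟩]
    simp

/-- The conditions on c discard the basis functions that do not vanish at 0 or that jump at 1.
Between knots the derivative is continuous by the Lipschitz bound, so it is a classical derivative
there. -/
theorem Regular.isPrimitive (h : Regular Q θ n p k C) (hn : 1 ≤ n) (hk : 1 ≤ k) (hkp : k ≤ p)
    {c : ℕ → ℝ} (h0 : ∀ i, i + k < p + 1 → c i = 0) (h1 : ∀ i, p + n ≤ i → c i = 0) :
    IsPrimitive (range (knot n p)) (spl Q θ n p (k + 1) c)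
      (spl Q θ n p k (dcoef Q θ n p k c)) := by
  have hzero : spl Q θ n p (k + 1) c 0 = 0 := spl_succ_zero hn hk h0 h1
  have hint : ∀ x, 0 ≤ x → spl Q θ n p (k + 1) c x =
      ∫ s in (0 : ℝ)..x, spl Q θ n p k (dcoef Q θ n p k c) s := by
    intro x hx
    rw [← h.spl_succ_sub hn hk hkp c le_rfl hx (Or.inr h1), hzero, sub_zero]
  have hii := fun {a b} => h.spl_intervalIntegrable hn hk (dcoef Q θ n p k c) (a := a) (b := b)
  refine ⟨countable_range _, h.spl_measurable _,
    ⟨_, fun x hx => h.abs_spl_le hn hk _ hx.1⟩, hzero, ?_, ?_, ?_⟩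
  · exact Finset.sum_eq_zero fun i _ => by
      rw [h.gbSpline_succ_eq_zero hn hk i zero_le_one (Or.inr (knot_le_one hn _)), mul_zero]
  · have := intervalIntegral.continuousOn_primitive_interval (μ := volume)
      ((intervalIntegrable_iff' (by simp)).1 (hii le_rfl zero_le_one))
    rw [uIcc_of_le zero_le_one] at this
    exact this.congr fun x hx => hint x hx.1
  · intro x hx
    have := intervalIntegral.integral_hasDerivAt_right (hii le_rfl hx.1.1.le)
      (h.spl_measurable _).stronglyMeasurable.stronglyMeasurableAtFilter
      (h.continuousAt_spl hn hk _ hx)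
    refine this.congr_of_eventuallyEq ?_
    filter_upwards [lt_mem_nhds hx.1.1] with y hy using hint y hy.le

/-- Cauchy–Schwarz with the nonnegative weights N_i bounds the square by C Σ d_i² N_i. Integration
gives d_i² ∫N_i = (c_i - c_{i-1})²/∫N_i at nondegenerate indices, and the lower mass bound supplies
the factor n. -/
theorem Regular.integral_dspl_sq_le (h : Regular Q θ n p k C) (hn : 1 ≤ n) (hk : 1 ≤ k)
    {c : ℕ → ℝ} (h0 : c 0 = 0) :
    ∫ s in (0 : ℝ)..1, spl Q θ n p k (dcoef Q θ n p k c) s ^ 2 ≤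
      64 * C ^ 5 * n * ∑ i ∈ Finset.range (p + n + 1), c i ^ 2 := by
  have hC := h.one_le
  set d := dcoef Q θ n p k c with hd
  have hpt : ∀ s ∈ Icc (0 : ℝ) 1, spl Q θ n p k d s ^ 2 ≤ C * spl Q θ n p k (fun i => d i ^ 2) s := by
    intro s hs
    have hN := fun i => h.nonneg hn hk i hs.1
    calc spl Q θ n p k d s ^ 2 ≤ spl Q θ n p k (fun i => d i ^ 2) s *
          ∑ i ∈ Finset.range (p + n + 1), gbSpline Q θ (knot n p) k i s :=
          Finset.sum_sq_le_sum_mul_sum_of_sq_le_mul _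
            (fun i _ => mul_nonneg (sq_nonneg _) (hN i)) (fun i _ => hN i) fun i _ => le_of_eq (by ring)
      _ ≤ spl Q θ n p k (fun i => d i ^ 2) s * C :=
          mul_le_mul_of_nonneg_left (h.sum_le s hs.1)
            (Finset.sum_nonneg fun i _ => mul_nonneg (sq_nonneg _) (hN i))
      _ = _ := mul_comm _ _
  have hsq : IntervalIntegrable (fun s => spl Q θ n p k d s ^ 2) volume 0 1 := by
    refine intervalIntegrable_of_abs_le ((h.spl_measurable d).pow_const 2)
      (C := (∑ i ∈ Finset.range (p + n + 1), |d i| * C) ^ 2) fun x hx => ?_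
    rw [uIcc_of_le zero_le_one] at hx
    rw [abs_pow]
    exact pow_le_pow_left₀ (abs_nonneg _) (h.abs_spl_le hn hk d hx.1) 2
  have hterm : ∀ i, d i ^ 2 * mass Q θ n p k i ≤ (c i - c (i - 1)) ^ 2 * (16 * C ^ 4 * n) := by
    intro i
    by_cases hi : p + 1 ≤ i + k ∧ i ≤ p + n
    · have hm := h.mass_pos hn hk hi.1 hi.2
      have hml := h.le_mass hn hk hi.1 hi.2
      rw [one_div_le (by positivity) hm] at hml
      have e : d i ^ 2 * mass Q θ n p k i = (c i - c (i - 1)) ^ 2 * (1 / mass Q θ n p k i) := by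
        rw [hd, dcoef]; field_simp
      rw [e]
      exact mul_le_mul_of_nonneg_left hml (sq_nonneg _)
    · rw [h.mass_eq_zero hn hk hi, mul_zero]
      positivity
  -- The truncated index repeats c 0, hence the assumption that it vanishes.
  have hshift : ∑ i ∈ Finset.range (p + n + 1), c (i - 1) ^ 2 ≤
      ∑ i ∈ Finset.range (p + n + 1), c i ^ 2 := by
    rw [Finset.sum_range_succ' (fun i => c (i - 1) ^ 2), Finset.sum_range_succ (fun i => c i ^ 2)]
    simp only [Nat.add_sub_cancel, Nat.zero_sub, h0]
    nlinarith [sq_nonneg (c (p + n))]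
  calc ∫ s in (0 : ℝ)..1, spl Q θ n p k d s ^ 2
      ≤ ∫ s in (0 : ℝ)..1, C * spl Q θ n p k (fun i => d i ^ 2) s :=
        intervalIntegral.integral_mono_on zero_le_one hsq
          ((h.spl_intervalIntegrable hn hk _ le_rfl zero_le_one).const_mul C) hpt
    _ = C * ∑ i ∈ Finset.range (p + n + 1), d i ^ 2 * mass Q θ n p k i := by
        rw [intervalIntegral.integral_const_mul, h.integral_spl hn hk _ le_rfl zero_le_one]; rfl
    _ ≤ C * ∑ i ∈ Finset.range (p + n + 1),
          ((32 * C ^ 4 * n) * c i ^ 2 + (32 * C ^ 4 * n) * c (i - 1) ^ 2) := by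
        refine mul_le_mul_of_nonneg_left (Finset.sum_le_sum fun i _ => (hterm i).trans ?_)
          (by linarith)
        have h1 : (c i - c (i - 1)) ^ 2 ≤ 2 * c i ^ 2 + 2 * c (i - 1) ^ 2 := by
          nlinarith [sq_nonneg (c i + c (i - 1))]
        have h2 := mul_le_mul_of_nonneg_right h1 (by positivity : 0 ≤ 16 * C ^ 4 * n)
        linarith
    _ ≤ C * ((32 * C ^ 4 * n) * (2 * ∑ i ∈ Finset.range (p + n + 1), c i ^ 2)) := by
        rw [Finset.sum_add_distrib, ← Finset.mul_sum, ← Finset.mul_sum, ← mul_add]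
        refine mul_le_mul_of_nonneg_left (mul_le_mul_of_nonneg_left ?_ (by positivity))
          (by linarith)
        linarith
    _ = _ := by ring

/-- The coefficients, indexed as the GB-splines, of the elements of the discretization space. -/
noncomputable def extend {m : ℕ} (x : Fin m → ℝ) (i : ℕ) : ℝ :=
  ∑ j, x j * (Pi.single ((j : ℕ) + 2) 1 : ℕ → ℝ) i

theorem extend_add_two {m : ℕ} (x : Fin m → ℝ) (j : Fin m) : extend x (j + 2) = x j := by
  rw [extend, Finset.sum_eq_single j]
  · simp
  · intro i _ hi
    rw [Pi.single_eq_of_ne (fun h => hi (Fin.ext (by omega))), mul_zero]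
  · simp

theorem extend_eq_zero {m : ℕ} (x : Fin m → ℝ) {i : ℕ} (hi : i < 2 ∨ m + 2 ≤ i) :
    extend x i = 0 :=
  Finset.sum_eq_zero fun j _ => by
    rw [Pi.single_eq_of_ne (by omega), mul_zero]

theorem sum_extend_sq {m : ℕ} (x : Fin m → ℝ) :
    ∑ i ∈ Finset.range (m + 3), extend x i ^ 2 = ∑ j, x j ^ 2 := by
  rw [Finset.sum_range_succ, Finset.sum_range_succ', Finset.sum_range_succ', Finset.sum_range,
    extend_eq_zero x (i := m + 2) (by omega), extend_eq_zero x (i := 0) (by omega),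
    extend_eq_zero x (i := 0 + 1) (by omega)]
  simp only [add_assoc, Nat.reduceAdd, extend_add_two]
  simp

theorem galerkinMatrix_cond2_le {C' : ℝ} (h : Regular Q θ n p k C)
    (h' : Regular Q θ n p (k + 1) C') (hn : 1 ≤ n) (hk : 1 ≤ k) (hp : p = k + 1) (β : ℝ)
    {γ : ℝ} (hγ : 0 ≤ γ) :
    IsUnit (galerkinMatrix Q θ n p β γ) ∧ cond2 (galerkinMatrix Q θ n p β γ) ≤
      (1 + |β| + γ) * (64 * C ^ 5 * p * C' ^ 2) * (n : ℝ) ^ 2 := by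
  have hC := h.one_le
  have hC' := h'.one_le
  have hn0 : (0 : ℝ) < n := by positivity
  have hp0 : (0 : ℝ) < p := by rw [hp]; positivity
  set m := n + p - 2 with hm
  have hext0 : ∀ x : Fin m → ℝ, ∀ i, i + k < p + 1 → extend x i = 0 := fun x i hi =>
    extend_eq_zero x (by omega)
  have hext1 : ∀ x : Fin m → ℝ, ∀ i, p + n ≤ i → extend x i = 0 := fun x i hi =>
    extend_eq_zero x (by omega)
  have hsum : ∀ (x : Fin m → ℝ) (s : ℝ), ∑ j, x j * spl Q θ n p k
      (dcoef Q θ n p k (Pi.single ((j : ℕ) + 2) 1)) s =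
      spl Q θ n p k (dcoef Q θ n p k (extend x)) s := by
    intro x s
    rw [sum_mul_spl]
    congr 1
    funext i
    exact sum_mul_dcoef x _ i
  have hprim : ∀ j : Fin m, IsPrimitive (range (knot n p))
      (gbSpline Q θ (knot n p) p ((j : ℕ) + 2))
      (spl Q θ n p k (dcoef Q θ n p k (Pi.single ((j : ℕ) + 2) 1))) := by
    intro j
    have := h.isPrimitive hn hk (by omega) (c := Pi.single ((j : ℕ) + 2) 1)
      (fun i hi => Pi.single_eq_of_ne (by omega) _) (fun i hi => Pi.single_eq_of_ne (by omega) _)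
    rw [show spl Q θ n p (k + 1) (Pi.single ((j : ℕ) + 2) 1) = _ from
      funext fun s => spl_single (by omega) s] at this
    rwa [← hp] at this
  have hlow : ∀ x : Fin m → ℝ, 1 / (n * p * C' ^ 2) * ∑ j, x j ^ 2 ≤
      ∫ s in (0 : ℝ)..1, (∑ j, x j * spl Q θ n p k
        (dcoef Q θ n p k (Pi.single ((j : ℕ) + 2) 1)) s) ^ 2 := by
    intro x
    simp_rw [hsum]
    set E := ∫ s in (0 : ℝ)..1, spl Q θ n p k (dcoef Q θ n p k (extend x)) s ^ 2 with hE
    have hE0 : 0 ≤ E := intervalIntegral.integral_nonneg zero_le_one fun s _ => sq_nonneg _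
    have hP := h.isPrimitive hn hk (by omega) (hext0 x) (hext1 x)
    have hx : ∀ j, x j ^ 2 ≤ C' ^ 2 * E := by
      intro j
      -- Any knot interval in the support of the basis function recovers its coefficient; this index
      -- picks the first one.
      have := h'.stable (max (j + 2) (p + 1)) (extend x) (√E) (by omega) (by omega)
        (fun s hs => hP.abs_le ⟨(knot_nonneg hn _).trans hs.1.le, hs.2.le.trans (knot_le_one hn _)⟩)
        (j + 2) (by omega) (by omega)
      rw [extend_add_two] at this
      calc x j ^ 2 = |x j| ^ 2 := (sq_abs _).symm
        _ ≤ (C' * √E) ^ 2 := pow_le_pow_left₀ (abs_nonneg _) this 2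
        _ = C' ^ 2 * E := by rw [mul_pow, Real.sq_sqrt hE0]
    have hcard : (m : ℝ) ≤ n * p := by
      have : m ≤ n * p := by
        obtain ⟨a, rfl⟩ : ∃ a, n = a + 1 := ⟨n - 1, by omega⟩
        have e : (a + 1) * (k + 1) = a * k + a + k + 1 := by ring
        rw [hm, hp, e]
        omega
      exact_mod_cast this
    rw [one_div, inv_mul_le_iff₀ (by positivity)]
    calc ∑ j, x j ^ 2 ≤ ∑ _j : Fin m, C' ^ 2 * E := Finset.sum_le_sum fun j _ => hx j
      _ = m * (C' ^ 2 * E) := by simp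
      _ ≤ n * p * (C' ^ 2 * E) := mul_le_mul_of_nonneg_right hcard (by positivity)
      _ = _ := by ring
  have hup : ∀ x : Fin m → ℝ, ∫ s in (0 : ℝ)..1, (∑ j, x j * spl Q θ n p k
      (dcoef Q θ n p k (Pi.single ((j : ℕ) + 2) 1)) s) ^ 2 ≤
      64 * C ^ 5 * n * ∑ j, x j ^ 2 := by
    intro x
    simp_rw [hsum]
    have := h.integral_dspl_sq_le hn hk (extend_eq_zero x (i := 0) (by omega))
    -- The three surplus indices 0, 1 and m + 2 = p + n carry zero coefficients.
    rwa [show p + n + 1 = m + 3 by omega, sum_extend_sq] at this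
  have := galerkin_cond2_le hprim (countable_range _) (β := β) hγ (by positivity)
    (by positivity) hlow hup
  refine ⟨this.1, this.2.trans (le_of_eq ?_)⟩
  field_simp

end Matrix

end GBSpline

theorem mainTheorem5 (Q : GBSpline.Kind) (μ : GBSpline.Mode) (p : ℕ) (hp : 2 ≤ p)
    (α : ℝ) (hα : 0 < α) (β γ : ℝ) (hγ : 0 ≤ γ) :
    ∃ C : ℝ, 0 < C ∧ ∀ n : ℕ, 2 ≤ n → GBSpline.Admissible Q (μ.param α n) n →
      IsUnit (GBSpline.galerkinMatrix Q (μ.param α n) n p β γ) ∧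
      GBSpline.cond2 (GBSpline.galerkinMatrix Q (μ.param α n) n p β γ) ≤ C * (n : ℝ) ^ 2 := by
  obtain ⟨K, hK, hodd⟩ := GBSpline.exists_oddBound Q μ hα
  obtain ⟨k, rfl⟩ : ∃ k, p = k + 1 := ⟨p - 1, by omega⟩
  obtain ⟨C, hC, h⟩ := GBSpline.exists_regular (k + 1) hK (k := k) (by omega) (by omega)
  obtain ⟨C', hC', h'⟩ := GBSpline.exists_regular (k + 1) hK (k := k + 1) (by omega) le_rfl
  refine ⟨(1 + |β| + γ) * (64 * C ^ 5 * (k + 1 : ℕ) * C' ^ 2), by positivity, fun n hn hadm => ?_⟩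
  have hb := hodd n (by omega) hadm
  exact GBSpline.galerkinMatrix_cond2_le (h Q _ n (by omega) hb) (h' Q _ n (by omega) hb)
    (by omega) (by omega) rfl β hγ
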